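/- Let $\Phi$ be the (reduced, crystallographic) root system of a connected complex semisimple algebraic group $G$, with simple roots $\alpha_1,\dots,\alpha_n$ (an arbitrary enumeration of the nodes $N_1,\dots,N_n$ of the Dynkin diagram), Weyl group $W$ with its Bruhat order, fundamental coweights $\omega_1,\dots,\omega_n$, and apartment $\mathbb A=X^\vee\otimes\mathbb R$ with the affine hyperplanes $H_{\alpha,m}=\{x\mid\langle\alpha,x\rangle+m=0\}$, reflections $s_{\alpha,m}$ ($\alpha\in\Phi$, $m\in\mathbb Z$), and affine Weyl group $W^{\mathfrak a}$ generated by these reflections. Faces are the closed faces of this arrangement; $F^o$ denotes the open face of $F$; vertices and edges are the faces of dimension $0$ and $1$; a vertex is special if for each root $\alpha$ it lies on some $H_{\alpha,m}$. Let $C^+$ be the dominant chamber and $C^-=-C^+$. A sector with vertex $V$ is a set $V+C$ with $C$ a closed Weyl chamber. A combinatorial one-skeleton gallery is a sequence $\gamma=(V_0\subset E_0\supset V_1\subset E_1\supset\cdots\subset E_r\supset V_{r+1})$ of vertices $V_i$ and edges $E_i$ in $\mathbb A$ with $V_0$, $V_{r+1}$ special. Its type is the sequence of the types of its faces, where the type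 of a face $F$ is the set of those affine roots $(\alpha,m)$ for which $H_{\alpha,m}$ cuts out a codimension-one face of the fundamental alcove and contains the $W^{\mathfrak a}$-conjugate of $F$ in the fundamental alcove. For a fundamental coweight $\omega$ let $\gamma_\omega$ be the gallery from $0$ to $\omega$ that runs through all edges contained in the segment $[0,\omega]$. For a dominant coweight $\lambda=\sum_i a_i\omega_i$ ($a_i\in\mathbb Z_{\ge0}$) let $\gamma_{\underline\lambda}$ be the concatenation (with displacement) of $a_1$ copies of $\gamma_{\omega_1}$, then $a_2$ copies of $\gamma_{\omega_2}$, \dots, then $a_n$ copies of $\gamma_{\omega_n}$. A two-step gallery $(V_0\subset E\supset V\subset F)$ is minimal if there is a chamber $C$ with $E\subset V_0+C$ and $F\subset V+C$. It is positively folded if there are edges $F_0,\dots,F_s=F$ ($s\ge0$) containing $V$ such that $(V_0\subset E\supset V\subset F_0)$ is minimal and for each $j=1,\dots,s$ there is $(\beta,m)$ with $V\in H_{\beta,m}$, $F_j=s_{\beta,m}(F_{j-1})$, such that $F_{j-1}$ and $V+C^-$ lie in one closed half-space bounded by $H_{\beta,m}$ while $F_j^o$ lies in the opposite open half-space. The gallery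 $\gamma$ is locally positively folded if all $(V_{i-1}\subset E_{i-1}\supset V_i\subset E_i)$, $1\le i\le r$, are positively folded. It is globally positively folded if it is locally positively folded and has a defining chain, that is, there are $\tau_0\ge\tau_1\ge\cdots\ge\tau_r$ in $W$ (Bruhat order) with $E_i\subset V_i+\tau_i(C^+)$ for all $i=0,\dots,r$. **Proposition.** Let $\lambda=\sum_i a_i\omega_i$ be a dominant coweight and suppose that the enumeration of the nodes satisfies the condition $(*)$ if $a_i\neq0$, then no node $N_j$ with $j<i$ is connected by an edge of the Dynkin diagram with a node $N_k$ with $k>i$. Let $\gamma\subset\mathbb A$ be a combinatorial one-skeleton gallery of the same type as $\gamma_{\underline\lambda}$. If $\gamma$ is locally positively folded, then $\gamma$ is globally positively folded. -/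

import Mathlib

noncomputable section

namespace OneSkeleton

open Set

section Defs

variable {ι M N : Type*} [AddCommGroup M] [Module ℝ M] [AddCommGroup N] [Module ℝ N]

/-! Throughout, `P` is the root system of `(G, T)`; its roots live in `M = X ⊗ ℝ`, and the
apartment is the space `N = X^∨ ⊗ ℝ` containing the coroots. The value `⟨α, x⟩` of the root with
index `i` at a point `x` of the apartment is `P.root' i x`. -/

/-! ### The affine hyperplane arrangement -/

/-- The affine hyperplane `H_{α,n} = {x | ⟨α, x⟩ + n = 0}`. -/
def wall (P : RootPairing ι ℝ M N) (i : ι) (n : ℤ) : Set N := {x | P.root' i x + n = 0}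

/-- The closed half-space `H⁺_{α,n} = {x | ⟨α, x⟩ + n ≥ 0}`. -/
def posHalf (P : RootPairing ι ℝ M N) (i : ι) (n : ℤ) : Set N := {x | 0 ≤ P.root' i x + n}

/-- The closed half-space `H⁻_{α,n} = {x | ⟨α, x⟩ + n ≤ 0}`. -/
def negHalf (P : RootPairing ι ℝ M N) (i : ι) (n : ℤ) : Set N := {x | P.root' i x + n ≤ 0}

/-- The affine reflection `s_{α,n} : x ↦ x - (⟨α, x⟩ + n) α^∨`. -/
def affineReflection (P : RootPairing ι ℝ M N) (i : ι) (n : ℤ) : N ≃ᵃ[ℝ] N :=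
  (P.coreflection i).toAffineEquiv.trans (AffineEquiv.constVAdd ℝ N (-((n : ℝ) • P.coroot i)))

theorem affineReflection_apply (P : RootPairing ι ℝ M N) (i : ι) (n : ℤ) (x : N) :
    affineReflection P i n x = x - (P.root' i x + n) • P.coroot i := by
  simp only [affineReflection, AffineEquiv.trans_apply, LinearEquiv.coe_toAffineEquiv,
    AffineEquiv.constVAdd_apply, vadd_eq_add, RootPairing.coreflection_apply]
  module

/-- The affine Weyl group, generated by all affine reflections. -/
def affineWeylGroup (P : RootPairing ι ℝ M N) : Subgroup (N ≃ᵃ[ℝ] N) :=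
  Subgroup.closure (range fun p : ι × ℤ => affineReflection P p.1 p.2)

/-! ### Faces

A face is obtained by choosing, for every affine root, the hyperplane or one of the two half-spaces
in such a way that the corresponding open face (the set of all points with exactly the chosen
signs) is non-empty. So it is determined by any point `x` of its open face, and as `Φ = -Φ` it is
the intersection of all the closed half-spaces `H⁺_{α,n}` (`α ∈ Φ`, `n ∈ ℤ`) that contain `x`. -/

/-- The (closed) face whose open face contains `x`. -/
def faceOf (P : RootPairing ι ℝ M N) (x : N) : Set N :=
  {y | ∀ (i : ι) (n : ℤ), x ∈ posHalf P i n → y ∈ posHalf P i n}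

/-- `F` is a (closed) face of the apartment. -/
def IsFace (P : RootPairing ι ℝ M N) (F : Set N) : Prop := ∃ x, F = faceOf P x

/-- The open face `F°` belonging to a closed face `F`. -/
def openFace (P : RootPairing ι ℝ M N) (F : Set N) : Set N := {x | faceOf P x = F}

/-- The open face of the face of `x` consists of the points having the same signs as `x` with
respect to all affine roots. -/
theorem mem_openFace_faceOf (P : RootPairing ι ℝ M N) (x y : N) :
    y ∈ openFace P (faceOf P x) ↔
      ∀ (i : ι) (n : ℤ), (y ∈ posHalf P i n ↔ x ∈ posHalf P i n) := by
  constructor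
  · intro h i n
    have hy : y ∈ faceOf P x := by
      rw [← show faceOf P y = faceOf P x from h]; exact fun _ _ h => h
    have hx : x ∈ faceOf P y := by
      rw [show faceOf P y = faceOf P x from h]; exact fun _ _ h => h
    exact ⟨hx i n, hy i n⟩
  · intro h
    ext z
    simp only [faceOf, mem_ofPred_eq, h]

/-- An edge is a face of dimension one. -/
def IsEdge (P : RootPairing ι ℝ M N) (F : Set N) : Prop :=
  IsFace P F ∧ Module.finrank ℝ (vectorSpan ℝ F) = 1

/-- A vertex is a face of dimension zero; it is regarded as a point. -/
def IsVertex (P : RootPairing ι ℝ M N) (v : N) : Prop := IsFace P {v}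

/-- A special vertex: every root belongs to `Φ_v`, that is, some `H_{α,n}` contains `v`. -/
def IsSpecialVertex (P : RootPairing ι ℝ M N) (v : N) : Prop :=
  IsVertex P v ∧ ∀ i : ι, ∃ n : ℤ, v ∈ wall P i n

/-! ### Chambers and sectors -/

/-- The dominant Weyl chamber `C⁺`. -/
def dominantChamber {P : RootPairing ι ℝ M N} (b : P.Base) : Set N :=
  {x | ∀ i, b.IsPos i → 0 ≤ P.root' i x}

/-- The antidominant Weyl chamber `C⁻ = -C⁺`. -/
def antidominantChamber {P : RootPairing ι ℝ M N} (b : P.Base) : Set N :=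
  {x | ∀ i, b.IsPos i → P.root' i x ≤ 0}

/-- A closed chamber: the closure of the connected component, in the complement of the linear
hyperplanes `H_{α,0}`, of a point `x` of this complement. -/
def IsChamber (P : RootPairing ι ℝ M N) (C : Set N) : Prop :=
  ∃ x, (∀ i, P.root' i x ≠ 0) ∧ C = {y | ∀ i, 0 < P.root' i x → 0 ≤ P.root' i y}

/-- The sector `v + C` with vertex `v`. -/
def sector (v : N) (C : Set N) : Set N := (fun z => v + z) '' C

/-! ### The fundamental alcove and types of faces -/

/-- The fundamental alcove `Δ_f`. -/
def fundamentalAlcove {P : RootPairing ι ℝ M N} (b : P.Base) : Set N :=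
  {x | ∀ i, b.IsPos i → 0 ≤ P.root' i x ∧ P.root' i x ≤ 1}

/-- The set `S^a` of affine roots `(α, n)` such that `Δ_f ∩ H_{α,n}` is a face of codimension
one. -/
def simpleAffineRoots {P : RootPairing ι ℝ M N} (b : P.Base) : Set (ι × ℤ) :=
  {p | IsFace P (fundamentalAlcove b ∩ wall P p.1 p.2) ∧
    Module.finrank ℝ (vectorSpan ℝ (fundamentalAlcove b ∩ wall P p.1 p.2)) + 1 =
      Module.finrank ℝ N}

/-- The type `S^a(F)` of a face `F`: the affine roots in `S^a` whose hyperplane contains the face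
`F'` of the fundamental alcove that is conjugate to `F` under the affine Weyl group. -/
def faceType {P : RootPairing ι ℝ M N} (b : P.Base) (F : Set N) : Set (ι × ℤ) :=
  {p | p ∈ simpleAffineRoots b ∧ ∃ F' : Set N, IsFace P F' ∧ F' ⊆ fundamentalAlcove b ∧
    (∃ w ∈ affineWeylGroup P, w '' F' = F) ∧ F' ⊆ wall P p.1 p.2}

/-! ### One-skeleton galleries -/

/-- The data of a gallery `(V_0 ⊂ E_0 ⊃ V_1 ⊂ ⋯ ⊃ V_r ⊂ E_r ⊃ V_{r+1})`, where `length = r + 1` is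
the number of edges. Only `vertex i` for `i ≤ length` and `edge i` for `i < length` are
meaningful. -/
structure Gallery (N : Type*) where
  length : ℕ
  vertex : ℕ → N
  edge : ℕ → Set N

/-- Combinatorial one-skeleton galleries. -/
structure Gallery.IsCombinatorial (P : RootPairing ι ℝ M N) (γ : Gallery N) : Prop where
  isVertex : ∀ i ≤ γ.length, IsVertex P (γ.vertex i)
  isEdge : ∀ i < γ.length, IsEdge P (γ.edge i)
  left_mem : ∀ i < γ.length, γ.vertex i ∈ γ.edge i
  right_mem : ∀ i < γ.length, γ.vertex (i + 1) ∈ γ.edge i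
  source_special : IsSpecialVertex P (γ.vertex 0)
  target_special : IsSpecialVertex P (γ.vertex γ.length)

/-- The gallery with a single vertex and no edge. -/
def Gallery.point (v : N) : Gallery N where
  length := 0
  vertex _ := v
  edge _ := ∅

/-- The concatenation `γ * γ'`: the gallery `γ` followed by `γ'`, displaced so that it starts in
the target of `γ`. -/
def Gallery.concat (γ γ' : Gallery N) : Gallery N where
  length := γ.length + γ'.length
  vertex k := if k ≤ γ.length then γ.vertex k else
    γ'.vertex (k - γ.length) + (γ.vertex γ.length - γ'.vertex 0)
  edge k := if k < γ.length then γ.edge k else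
    (fun x => x + (γ.vertex γ.length - γ'.vertex 0)) '' γ'.edge (k - γ.length)

/-- Two galleries have the same type. -/
def Gallery.SameType {P : RootPairing ι ℝ M N} (b : P.Base) (γ γ' : Gallery N) : Prop :=
  γ.length = γ'.length ∧
    (∀ i ≤ γ.length, faceType b {γ.vertex i} = faceType b {γ'.vertex i}) ∧
    (∀ i < γ.length, faceType b (γ.edge i) = faceType b (γ'.edge i))

/-! ### Fundamental coweights, fundamental galleries and the gallery of a dominant coweight -/

/-- The fundamental coweight `ω_j`, determined by `⟨α_k, ω_j⟩ = δ_{jk}` for all simple roots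
`α_k`. -/
def fundamentalCoweight {P : RootPairing ι ℝ M N} [P.IsRootSystem] (b : P.Base)
    (j : b.support) : N :=
  P.toLinearMap.flip.toPerfPair.symm (b.toWeightBasis.coord j)

theorem root'_fundamentalCoweight {P : RootPairing ι ℝ M N} [P.IsRootSystem] (b : P.Base)
    [DecidableEq b.support] (j k : b.support) :
    P.root' k (fundamentalCoweight b j) = if k = j then 1 else 0 := by
  have h : P.toLinearMap.flip.toPerfPair (fundamentalCoweight b j) = b.toWeightBasis.coord j := by
    simp [fundamentalCoweight]
  have h2 := LinearMap.congr_fun h (P.root k)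
  simp only [Module.Basis.coord_apply, RootPairing.Base.toWeightBasis_repr_root,
    Finsupp.single_apply] at h2
  simpa using h2

/-- The parameters `t ∈ [0, 1]` for which `t w` lies in a hyperplane `H_{α,n}` that does not
contain the ray through `w`. If this ray is an extremal ray of a chamber, these are the `t ∈ [0, 1]`
for which `t w` is a vertex. -/
def breakpoints (P : RootPairing ι ℝ M N) (w : N) : Set ℝ :=
  {t | t ∈ Icc (0 : ℝ) 1 ∧ ∃ (i : ι) (n : ℤ), P.root' i w ≠ 0 ∧ t • w ∈ wall P i n}

theorem finite_breakpoints [Finite ι] (P : RootPairing ι ℝ M N) (w : N) :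
    (breakpoints P w).Finite := by
  have key : ∀ i : ι, {t : ℝ | t ∈ Icc (0 : ℝ) 1 ∧
      ∃ n : ℤ, P.root' i w ≠ 0 ∧ t • w ∈ wall P i n}.Finite := by
    intro i
    obtain ⟨K, hK⟩ := exists_nat_gt |P.root' i w|
    refine ((finite_Icc (-(K : ℤ)) K).image (fun n : ℤ => -(n : ℝ) / P.root' i w)).subset ?_
    rintro t ⟨⟨h0, h1⟩, n, hne, hn⟩
    have hn' : t * P.root' i w + n = 0 := by simpa [wall] using hn
    have habs : |(n : ℝ)| ≤ K := by
      have : (n : ℝ) = -(t * P.root' i w) := by linarith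
      rw [this, abs_neg, abs_mul, abs_of_nonneg h0]
      nlinarith [abs_nonneg (P.root' i w)]
    rw [abs_le] at habs
    refine ⟨n, ⟨by exact_mod_cast habs.1, by exact_mod_cast habs.2⟩, ?_⟩
    show -(n : ℝ) / P.root' i w = t
    rw [div_eq_iff hne]
    linarith
  refine (finite_iUnion key).subset ?_
  rintro t ⟨ht, i, n, h⟩
  exact mem_iUnion.2 ⟨i, ht, n, h⟩

/-- The fundamental gallery `γ_ω`: starting in the origin, it runs through all the edges contained
in the segment from the origin to `ω`. -/
def fundamentalGallery [Finite ι] {P : RootPairing ι ℝ M N} [P.IsRootSystem] (b : P.Base)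
    (j : b.support) : Gallery N :=
  let w := fundamentalCoweight b j
  let ts : List ℝ := (finite_breakpoints P w).toFinset.sort (· ≤ ·)
  { length := ts.length - 1
    vertex := fun k => ts.getD k 0 • w
    edge := fun k => segment ℝ (ts.getD k 0 • w) (ts.getD (k + 1) 0 • w) }

/-- For the enumeration `e` of the nodes of the Dynkin diagram, hence of the fundamental coweights
`ω_1, …, ω_n`, and the dominant coweight `λ = ∑ a_i ω_i`, the gallery
`γ_λ = γ_{ω_1} * ⋯ * γ_{ω_1} * ⋯ * γ_{ω_n} * ⋯ * γ_{ω_n}`, in which `γ_{ω_i}` occurs `a_i` times. -/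
def dominantGallery [Finite ι] {P : RootPairing ι ℝ M N} [P.IsRootSystem] (b : P.Base) {n : ℕ}
    (e : Fin n ≃ b.support) (a : Fin n → ℕ) : Gallery N :=
  ((List.finRange n).flatMap fun i => List.replicate (a i) (fundamentalGallery b (e i))).foldl
    Gallery.concat (Gallery.point 0)

/-- The underlying graph of the Dynkin diagram: its nodes are the simple roots, two of which are
connected if and only if they are not orthogonal. -/
def dynkinGraph {P : RootPairing ι ℝ M N} (b : P.Base) : SimpleGraph b.support :=
  SimpleGraph.fromRel fun j k => P.pairing j k ≠ 0

/-- The condition on the enumeration `N_1, …, N_n` of the nodes for the dominant coweight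
`λ = ∑ a_i ω_i`: if `N_i` is in the support of `λ`, then no node `N_j` with `j < i` is connected in
the Dynkin diagram with a node `N_k` with `k > i`. -/
def ConditionStar {P : RootPairing ι ℝ M N} (b : P.Base) {n : ℕ} (e : Fin n ≃ b.support)
    (a : Fin n → ℕ) : Prop :=
  ∀ i, a i ≠ 0 → ∀ j k, j < i → i < k → ¬ (dynkinGraph b).Adj (e j) (e k)

/-! ### The Weyl group and its Bruhat order -/

/-- The Weyl group, as the group of linear automorphisms of the apartment generated by the
reflections `s_{α,0}`. -/
def weylGroup (P : RootPairing ι ℝ M N) : Subgroup (N ≃ₗ[ℝ] N) :=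
  Subgroup.closure (range P.coreflection)

/-- The length of a Weyl group element: the minimal number of factors in an expression as a product
of simple reflections. -/
def weylLength {P : RootPairing ι ℝ M N} (b : P.Base) (w : weylGroup P) : ℕ :=
  sInf {k | ∃ l : List ι, (∀ i ∈ l, i ∈ b.support) ∧ l.length = k ∧
    (l.map P.coreflection).prod = (w : N ≃ₗ[ℝ] N)}

/-- The Bruhat order `u ≤ v`: there is a chain from `u` to `v` in which each element is obtained
from the preceding one by multiplication by a reflection and has larger length. -/
def BruhatLE {P : RootPairing ι ℝ M N} (b : P.Base) : weylGroup P → weylGroup P → Prop :=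
  Relation.ReflTransGen fun u v =>
    (∃ i, (v : N ≃ₗ[ℝ] N) = P.coreflection i * u) ∧ weylLength b u < weylLength b v

/-! ### Positively folded galleries -/

/-- The wall `H_{α,n}` separates `Ω` from the face `F`: one of the two closed half-spaces contains
`Ω`, and the opposite open half-space contains `F°`. -/
def Separates (P : RootPairing ι ℝ M N) (i : ι) (n : ℤ) (Ω F : Set N) : Prop :=
  (Ω ⊆ negHalf P i n ∧ openFace P F ⊆ (negHalf P i n)ᶜ) ∨
    (Ω ⊆ posHalf P i n ∧ openFace P F ⊆ (posHalf P i n)ᶜ)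

/-- The two-step gallery `(V₀ ⊂ E ⊃ V ⊂ F)` is minimal. -/
def IsMinimalTwoStep (P : RootPairing ι ℝ M N) (V₀ : N) (E : Set N) (V : N) (F : Set N) : Prop :=
  ∃ C, IsChamber P C ∧ E ⊆ sector V₀ C ∧ F ⊆ sector V C

/-- `(E ⊃ V ⊂ F')` is obtained from `(E ⊃ V ⊂ F)` by a positive folding. -/
def IsPositiveFolding {P : RootPairing ι ℝ M N} (b : P.Base) (V : N) (F F' : Set N) : Prop :=
  ∃ (i : ι) (n : ℤ), V ∈ wall P i n ∧ F' = affineReflection P i n '' F ∧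
    Separates P i n (F ∪ sector V (antidominantChamber b)) F'

/-- The two-step gallery `(V₀ ⊂ E ⊃ V ⊂ F)` is positively folded: `F` is the last term of a
sequence `F_0, …, F_s` of edges containing `V` such that `(V₀ ⊂ E ⊃ V ⊂ F_0)` is minimal and each
further term arises from the preceding one by a positive folding. For `s = 0` this is the case of a
minimal gallery. -/
def IsPositivelyFoldedTwoStep {P : RootPairing ι ℝ M N} (b : P.Base)
    (V₀ : N) (E : Set N) (V : N) (F : Set N) : Prop :=
  ∃ (s : ℕ) (Fs : ℕ → Set N), (∀ j ≤ s, IsEdge P (Fs j) ∧ V ∈ Fs j) ∧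
    IsMinimalTwoStep P V₀ E V (Fs 0) ∧ Fs s = F ∧
    ∀ j < s, IsPositiveFolding b V (Fs j) (Fs (j + 1))

/-- Locally positively folded galleries: all their two-step galleries are positively folded. -/
def Gallery.IsLocallyPositivelyFolded {P : RootPairing ι ℝ M N} (b : P.Base) (γ : Gallery N) :
    Prop :=
  ∀ i, i + 1 < γ.length → IsPositivelyFoldedTwoStep b
    (γ.vertex i) (γ.edge i) (γ.vertex (i + 1)) (γ.edge (i + 1))

/-- `(τ_0, …, τ_r)` is a defining chain for `γ`: the edge `E_i` is contained in the sector
`V_i + τ_i(C⁺)`, and `τ_0 ≥ ⋯ ≥ τ_r` in the Bruhat order. -/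
def Gallery.IsDefiningChain {P : RootPairing ι ℝ M N} (b : P.Base) (γ : Gallery N)
    (τ : ℕ → weylGroup P) : Prop :=
  (∀ i < γ.length, γ.edge i ⊆ sector (γ.vertex i) ((τ i : N ≃ₗ[ℝ] N) '' dominantChamber b)) ∧
    ∀ i, i + 1 < γ.length → BruhatLE b (τ (i + 1)) (τ i)

/-- Globally positively folded galleries. -/
def Gallery.IsGloballyPositivelyFolded {P : RootPairing ι ℝ M N} (b : P.Base) (γ : Gallery N) :
    Prop :=
  γ.IsLocallyPositivelyFolded b ∧ ∃ τ : ℕ → weylGroup P, γ.IsDefiningChain b τ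

end Defs

end OneSkeleton

end

namespace OneSkeleton

open Set

/-! ### The Weyl group: root action, length and Bruhat order. -/

section WeylGroup

variable {ι M N : Type*} [AddCommGroup M] [Module ℝ M] [AddCommGroup N] [Module ℝ N]

theorem root'_reflectionPerm (P : RootPairing ι ℝ M N) (i j : ι) (x : N) :
    P.root' (P.reflectionPerm i j) x = P.root' j (P.coreflection i x) :=
  LinearMap.congr_fun (P.flip.coroot'_reflectionPerm (i := i) (j := j)) x

theorem root'_reflectionPerm_self (P : RootPairing ι ℝ M N) (i : ι) (x : N) :
    P.root' (P.reflectionPerm i i) x = -P.root' i x := by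
  rw [root'_reflectionPerm, P.coreflection_apply, map_sub, map_smul, P.root'_coroot_eq_pairing,
    P.pairing_same, smul_eq_mul]
  ring

theorem coreflection_reflectionPerm (P : RootPairing ι ℝ M N) (i j : ι) :
    P.coreflection (P.reflectionPerm j i) =
      P.coreflection j * P.coreflection i * P.coreflection j :=
  P.flip.reflection_reflectionPerm

theorem coreflection_mul_self (P : RootPairing ι ℝ M N) (i : ι) :
    P.coreflection i * P.coreflection i = 1 := by
  rw [← sq, P.coreflection_sq]

theorem coreflection_reflectionPerm_self (P : RootPairing ι ℝ M N) (i : ι) :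
    P.coreflection (P.reflectionPerm i i) = P.coreflection i := by
  rw [coreflection_reflectionPerm, coreflection_mul_self, one_mul]

theorem isPos_reflectionPerm_self {P : RootPairing ι ℝ M N} (b : P.Base) (i : ι) :
    b.IsPos (P.reflectionPerm i i) ↔ ¬ b.IsPos i :=
  RootPairing.Base.IsPos.neg_iff_not b i

/-- The reflection in a root, as an element of the Weyl group. -/
noncomputable def weylReflection (P : RootPairing ι ℝ M N) (i : ι) : weylGroup P :=
  ⟨P.coreflection i, Subgroup.subset_closure ⟨i, rfl⟩⟩

@[simp]
theorem coe_weylReflection (P : RootPairing ι ℝ M N) (i : ι) :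
    (weylReflection P i : N ≃ₗ[ℝ] N) = P.coreflection i := rfl

theorem weylReflection_mul_self (P : RootPairing ι ℝ M N) (i : ι) :
    weylReflection P i * weylReflection P i = 1 :=
  Subtype.ext (coreflection_mul_self P i)

theorem weylGroup_induction (P : RootPairing ι ℝ M N) {p : weylGroup P → Prop} (one : p 1)
    (mul : ∀ i w, p w → p (weylReflection P i * w)) (w : weylGroup P) : p w := by
  obtain ⟨w, hw⟩ := w
  induction hw using Subgroup.closure_induction_left with
  | one => exact one
  | mul_left x hx y hy ih =>
    obtain ⟨i, rfl⟩ := hx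
    exact mul i ⟨y, hy⟩ ih
  | inv_mul_cancel x hx y hy ih =>
    obtain ⟨i, rfl⟩ := hx
    -- The inverse of a reflection unfolds to the reflection itself.
    exact mul i ⟨y, hy⟩ ih

/-- The Weyl group permutes the roots. -/
theorem exists_root'_apply_weylGroup (P : RootPairing ι ℝ M N) (w : weylGroup P) (j : ι) :
    ∃ k, (∀ x, P.root' j ((w : N ≃ₗ[ℝ] N) x) = P.root' k x) ∧
      weylReflection P j * w = w * weylReflection P k := by
  induction w using weylGroup_induction generalizing j with
  | one => exact ⟨j, fun _ => rfl, by simp⟩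
  | mul i w ih =>
    obtain ⟨k, hk, hk'⟩ := ih (P.reflectionPerm i j)
    refine ⟨k, fun x => ?_, ?_⟩
    · rw [← hk, root'_reflectionPerm]; rfl
    · have h : weylReflection P j * weylReflection P i =
          weylReflection P i * weylReflection P (P.reflectionPerm i j) := by
        ext1
        simp only [Subgroup.coe_mul, coe_weylReflection, coreflection_reflectionPerm]
        rw [← mul_assoc, ← mul_assoc, coreflection_mul_self, one_mul]
      rw [← mul_assoc, h, mul_assoc, hk', mul_assoc]

/-- This converts right multiplication by a reflection, which moves within cosets, into left
multiplication, in which the Bruhat order is expressed. -/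
theorem exists_root'_apply_eq (P : RootPairing ι ℝ M N) (w : weylGroup P) (i : ι) :
    ∃ k, (∀ x, P.root' k ((w : N ≃ₗ[ℝ] N) x) = P.root' i x) ∧
      w * weylReflection P i = weylReflection P k * w := by
  obtain ⟨k, hk, hk'⟩ := exists_root'_apply_weylGroup P w⁻¹ i
  refine ⟨k, fun x => ?_, ?_⟩
  · rw [← hk]
    exact congrArg _ ((w : N ≃ₗ[ℝ] N).symm_apply_apply x)
  · rw [← mul_left_inj w⁻¹, mul_assoc, hk', ← mul_assoc, mul_inv_cancel, one_mul, mul_assoc,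
      mul_inv_cancel, mul_one]

/-- The product of the reflections in the roots of a list. -/
noncomputable def weylProd (P : RootPairing ι ℝ M N) (l : List ι) : weylGroup P :=
  (l.map (weylReflection P)).prod

theorem coe_weylProd (P : RootPairing ι ℝ M N) (l : List ι) :
    (weylProd P l : N ≃ₗ[ℝ] N) = (l.map P.coreflection).prod := by
  induction l with
  | nil => rfl
  | cons i l ih =>
    rw [List.map_cons, List.prod_cons, ← ih]; rfl

@[simp]
theorem weylProd_nil (P : RootPairing ι ℝ M N) : weylProd P [] = 1 := rfl

@[simp]
theorem weylProd_cons (P : RootPairing ι ℝ M N) (i : ι) (l : List ι) :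
    weylProd P (i :: l) = weylReflection P i * weylProd P l := by
  simp [weylProd]

@[simp]
theorem weylProd_append (P : RootPairing ι ℝ M N) (l l' : List ι) :
    weylProd P (l ++ l') = weylProd P l * weylProd P l' := by
  simp [weylProd]

variable {P : RootPairing ι ℝ M N} (b : P.Base)

theorem weylLength_le {l : List ι} (hl : ∀ i ∈ l, i ∈ b.support) :
    weylLength b (weylProd P l) ≤ l.length :=
  Nat.sInf_le ⟨l, hl, rfl, (coe_weylProd P l).symm⟩

variable [Finite ι] [P.IsCrystallographic] [P.IsReduced]

/-- Simple reflections carry simple roots to all roots up to sign, so each reflection is a conjugate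
of a simple one by a word in simple ones. -/
theorem exists_weylProd_eq (w : weylGroup P) :
    ∃ l : List ι, (∀ i ∈ l, i ∈ b.support) ∧ weylProd P l = w := by
  have key (i : ι) : ∃ l : List ι, (∀ j ∈ l, j ∈ b.support) ∧
      weylProd P l = weylReflection P i := by
    induction i using b.induction_reflect with
    | h₀ i ih =>
      obtain ⟨l, hl, h⟩ := ih
      exact ⟨l, hl, h.trans (Subtype.ext (coreflection_reflectionPerm_self P i).symm)⟩
    | h₁ i hi => exact ⟨[i], by simpa using hi, by simp⟩
    | h₂ i j ih hj =>
      obtain ⟨l, hl, h⟩ := ih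
      refine ⟨j :: (l ++ [j]), ?_, ?_⟩
      · simp only [List.mem_cons, List.mem_append, List.not_mem_nil, or_false]
        rintro k (rfl | hk | rfl)
        exacts [hj, hl k hk, hj]
      · ext1
        simp [h, coreflection_reflectionPerm, mul_assoc]
  induction w using weylGroup_induction with
  | one => exact ⟨[], by simp, rfl⟩
  | mul i w ih =>
    obtain ⟨l, hl, rfl⟩ := ih
    obtain ⟨l', hl', h⟩ := key i
    refine ⟨l' ++ l, fun j hj => ?_, by simp [h]⟩
    exact (List.mem_append.1 hj).elim (hl' j) (hl j)

theorem exists_reduced_word (w : weylGroup P) :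
    ∃ l : List ι, (∀ i ∈ l, i ∈ b.support) ∧ l.length = weylLength b w ∧ weylProd P l = w := by
  obtain ⟨l, hl, hw⟩ := exists_weylProd_eq b w
  obtain ⟨l', hl', h, h'⟩ := Nat.sInf_mem (s := {k | ∃ l : List ι, (∀ i ∈ l, i ∈ b.support) ∧
    l.length = k ∧ (l.map P.coreflection).prod = (w : N ≃ₗ[ℝ] N)})
    ⟨l.length, l, hl, rfl, by rw [← hw, coe_weylProd]⟩
  exact ⟨l', hl', h, Subtype.ext ((coe_weylProd P l').trans h')⟩

/-- A point in the interior of the fundamental alcove. -/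
def IsAlcoveInterior (p : N) : Prop := ∀ i, b.IsPos i → 0 < P.root' i p ∧ P.root' i p < 1

-- The sum of the fundamental coweights is 1 on simple roots, hence positive on positive roots;
-- scaling makes all values less than 1. Such a point `p` lies on no wall, and the sign of a
-- positive root at `w p` decides whether its reflection lengthens or shortens `w`.
omit [P.IsReduced] in
theorem exists_isAlcoveInterior [P.IsRootSystem] : ∃ p, IsAlcoveInterior b p := by
  classical
  set ρ : N := ∑ j, fundamentalCoweight b j
  have hsimple (i : ι) (hi : i ∈ b.support) : P.root' i ρ = 1 := by
    have := fun j => root'_fundamentalCoweight b j ⟨i, hi⟩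
    simp only [ρ, map_sum, this]
    simp
  have hpos (i : ι) (hi : b.IsPos i) : 0 < P.root' i ρ := by
    refine hi.induction_on_add (p := fun i => 0 < P.root' i ρ) (fun i hi => ?_)
      fun i j k h hi hj => ?_
    · rw [hsimple i hi]; exact one_pos
    · have : P.root' k ρ = P.root' i ρ + P.root' j ρ := by
        simp [RootPairing.root', h]
      rw [this, hsimple j hj]
      linarith
  obtain ⟨K, hK⟩ := (Set.finite_range fun i => P.root' i ρ).bddAbove
  have hK' (i : ι) : P.root' i ρ < |K| + 1 :=
    (hK ⟨i, rfl⟩).trans_lt (by linarith [le_abs_self K])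
  refine ⟨(|K| + 1)⁻¹ • ρ, fun i hi => ?_⟩
  rw [map_smul, smul_eq_mul]
  have h0 : 0 < |K| + 1 := by positivity
  refine ⟨mul_pos (inv_pos.2 h0) (hpos i hi), ?_⟩
  rw [inv_mul_lt_iff₀ h0]
  linarith [hK' i]

variable {b} {p : N}

omit [Finite ι] [P.IsCrystallographic] [P.IsReduced] in
theorem IsAlcoveInterior.pos_iff (hp : IsAlcoveInterior b p) (i : ι) :
    0 < P.root' i p ↔ b.IsPos i := by
  refine ⟨fun h => ?_, fun h => (hp i h).1⟩
  by_contra hi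
  have := (hp _ ((isPos_reflectionPerm_self b i).2 hi)).1
  rw [root'_reflectionPerm_self] at this
  linarith

omit [Finite ι] [P.IsCrystallographic] [P.IsReduced] in
theorem IsAlcoveInterior.neg_iff (hp : IsAlcoveInterior b p) (i : ι) :
    P.root' i p < 0 ↔ ¬ b.IsPos i := by
  rw [← isPos_reflectionPerm_self, ← hp.pos_iff, root'_reflectionPerm_self, neg_pos]

omit [Finite ι] [P.IsCrystallographic] [P.IsReduced] in
theorem IsAlcoveInterior.ne_zero (hp : IsAlcoveInterior b p) (i : ι) : P.root' i p ≠ 0 := by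
  by_cases hi : b.IsPos i
  · exact ((hp.pos_iff i).2 hi).ne'
  · exact ((hp.neg_iff i).2 hi).ne

omit [Finite ι] [P.IsCrystallographic] [P.IsReduced] in
theorem IsAlcoveInterior.apply_ne_zero (hp : IsAlcoveInterior b p) (w : weylGroup P) (i : ι) :
    P.root' i ((w : N ≃ₗ[ℝ] N) p) ≠ 0 := by
  obtain ⟨k, hk, -⟩ := exists_root'_apply_weylGroup P w i
  rw [hk]
  exact hp.ne_zero k

/-- The exchange condition. -/
theorem exists_word_reflection_mul (hp : IsAlcoveInterior b p) (l : List ι)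
    (hl : ∀ i ∈ l, i ∈ b.support) (j : ι) (hj : b.IsPos j)
    (h : P.root' j ((weylProd P l : N ≃ₗ[ℝ] N) p) < 0) :
    ∃ l' : List ι, (∀ i ∈ l', i ∈ b.support) ∧ l'.length < l.length ∧
      weylProd P l' = weylReflection P j * weylProd P l := by
  induction l generalizing j with
  | nil => exact absurd ((hp.pos_iff j).2 hj) (not_lt.2 h.le)
  | cons i l ih =>
    have hi : i ∈ b.support := hl i (by simp)
    have hl' : ∀ k ∈ l, k ∈ b.support := fun k hk => hl k (by simp [hk])
    -- If the first letter is `j` itself, it cancels. Otherwise the simple reflection in `i` keeps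
    -- `j` positive, and the tail of the word is treated by induction with the reflected root.
    by_cases hij : j = i
    · subst hij
      exact ⟨l, hl', by simp, by simp [← mul_assoc, weylReflection_mul_self]⟩
    · obtain ⟨l', h1, h2, h3⟩ := ih hl' (P.reflectionPerm i j) (hj.reflectionPerm hi hij)
        (by rw [root'_reflectionPerm]; simpa using h)
      refine ⟨i :: l', by simpa using ⟨hi, h1⟩, by simpa using h2, ?_⟩
      have h4 : weylReflection P (P.reflectionPerm i j) =
          weylReflection P i * weylReflection P j * weylReflection P i :=
        Subtype.ext (coreflection_reflectionPerm P j i)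
      rw [weylProd_cons, weylProd_cons, h3, h4, ← mul_assoc, ← mul_assoc, ← mul_assoc,
        weylReflection_mul_self, one_mul, mul_assoc]

theorem weylLength_reflection_mul_lt (hp : IsAlcoveInterior b p) {j : ι} (hj : b.IsPos j)
    {w : weylGroup P} (h : P.root' j ((w : N ≃ₗ[ℝ] N) p) < 0) :
    weylLength b (weylReflection P j * w) < weylLength b w := by
  obtain ⟨l, hl, hlen, rfl⟩ := exists_reduced_word b w
  obtain ⟨l', h1, h2, h3⟩ := exists_word_reflection_mul hp l hl j hj h
  rw [← h3, ← hlen]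
  exact (weylLength_le b h1).trans_lt h2

theorem weylLength_lt_reflection_mul (hp : IsAlcoveInterior b p) {j : ι} (hj : b.IsPos j)
    {w : weylGroup P} (h : 0 < P.root' j ((w : N ≃ₗ[ℝ] N) p)) :
    weylLength b w < weylLength b (weylReflection P j * w) := by
  have := weylLength_reflection_mul_lt hp hj (w := weylReflection P j * w) (by
    rw [Subgroup.coe_mul, coe_weylReflection, LinearEquiv.mul_apply, ← root'_reflectionPerm,
      root'_reflectionPerm_self]
    linarith)
  rwa [← mul_assoc, weylReflection_mul_self, one_mul] at this

theorem bruhatLE_reflection_mul (hp : IsAlcoveInterior b p) {j : ι} (hj : b.IsPos j)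
    {w : weylGroup P} (h : P.root' j ((w : N ≃ₗ[ℝ] N) p) < 0) :
    BruhatLE b (weylReflection P j * w) w := by
  refine Relation.ReflTransGen.single ⟨⟨j, ?_⟩, weylLength_reflection_mul_lt hp hj h⟩
  change (w : N ≃ₗ[ℝ] N) = ((weylReflection P j * (weylReflection P j * w) : weylGroup P) : _)
  rw [← mul_assoc, weylReflection_mul_self, one_mul]

/-! ### Right multiplication by a simple reflection -/

-- Moved to the left, the reflection belongs to a positive root up to sign, and that root does not
-- vanish at `w p`; either sign gives a strict inequality.
variable (b) in
theorem weylLength_mul_simple_ne [P.IsRootSystem] (w : weylGroup P) (i : ι) :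
    weylLength b (w * weylReflection P i) ≠ weylLength b w := by
  obtain ⟨p, hp⟩ := exists_isAlcoveInterior b
  obtain ⟨k, -, hw⟩ := exists_root'_apply_eq P w i
  have key (j : ι) (hj : b.IsPos j) :
      weylLength b (weylReflection P j * w) ≠ weylLength b w := by
    rcases lt_or_gt_of_ne (hp.apply_ne_zero w j) with h | h
    · exact (weylLength_reflection_mul_lt hp hj h).ne
    · exact (weylLength_lt_reflection_mul hp hj h).ne'
  rw [hw]
  by_cases hpos : b.IsPos k
  · exact key k hpos
  · have : weylReflection P k = weylReflection P (P.reflectionPerm k k) :=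
      Subtype.ext (coreflection_reflectionPerm_self P k).symm
    rw [this]
    exact key _ ((isPos_reflectionPerm_self b k).2 hpos)

variable (b) in
/-- One step of the Bruhat order. -/
def BruhatStep (u v : weylGroup P) : Prop :=
  (∃ i, (v : N ≃ₗ[ℝ] N) = P.coreflection i * u) ∧ weylLength b u < weylLength b v

variable (b) in
omit [Finite ι] [P.IsCrystallographic] [P.IsReduced] in
theorem exists_isPos_of_bruhatStep {u v : weylGroup P} (h : BruhatStep b u v) :
    ∃ i, b.IsPos i ∧ v = weylReflection P i * u := by
  obtain ⟨⟨i, hi⟩, -⟩ := h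
  by_cases hpos : b.IsPos i
  · exact ⟨i, hpos, Subtype.ext hi⟩
  · exact ⟨_, (isPos_reflectionPerm_self b i).2 hpos,
      Subtype.ext (by simpa [coreflection_reflectionPerm_self] using hi)⟩

-- The lifting property. Write `v = s_j u = u s_k` with `k = u⁻¹ j`, which is positive because `v`
-- is longer. Unless `k = i`, the simple reflection in `i` keeps `k` positive, so `s_j` also
-- lengthens `u s_i`.
variable (b) in
theorem bruhatStep_mul_simple [P.IsRootSystem] {u v : weylGroup P} (h : BruhatStep b u v) {i : ι}
    (hi : i ∈ b.support) :
    u * weylReflection P i = v ∨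
      BruhatStep b (u * weylReflection P i) (v * weylReflection P i) := by
  obtain ⟨p, hp⟩ := exists_isAlcoveInterior b
  obtain ⟨j, hj, rfl⟩ := exists_isPos_of_bruhatStep b h
  have hpos : 0 < P.root' j ((u : N ≃ₗ[ℝ] N) p) := by
    rcases lt_or_gt_of_ne (hp.apply_ne_zero u j) with h' | h'
    · exact absurd h.2 (weylLength_reflection_mul_lt hp hj h').not_gt
    · exact h'
  obtain ⟨k, hk, hk'⟩ := exists_root'_apply_weylGroup P u j
  rw [hk, hp.pos_iff] at hpos
  by_cases hki : k = i
  · exact Or.inl (by rw [hk', hki])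
  · refine Or.inr ⟨⟨j, by simp [mul_assoc]⟩, ?_⟩
    rw [mul_assoc]
    refine weylLength_lt_reflection_mul hp hj ?_
    rw [Subgroup.coe_mul, LinearEquiv.mul_apply, hk, coe_weylReflection, ← root'_reflectionPerm,
      hp.pos_iff]
    exact hpos.reflectionPerm hi hki

variable (b) in
/-- The longer one of `w` and `w s`. -/
noncomputable def bruhatUp (i : ι) (w : weylGroup P) : weylGroup P :=
  if weylLength b w < weylLength b (w * weylReflection P i) then w * weylReflection P i else w

variable (b) in
/-- The shorter one of `w` and `w s`. -/
noncomputable def bruhatDown (i : ι) (w : weylGroup P) : weylGroup P :=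
  if weylLength b (w * weylReflection P i) < weylLength b w then w * weylReflection P i else w

omit [Finite ι] [P.IsCrystallographic] [P.IsReduced] in
theorem bruhatLE_refl (w : weylGroup P) : BruhatLE b w w := Relation.ReflTransGen.refl

omit [Finite ι] [P.IsCrystallographic] [P.IsReduced] in
theorem BruhatLE.trans {u v w : weylGroup P} (h : BruhatLE b u v) (h' : BruhatLE b v w) :
    BruhatLE b u w := Relation.ReflTransGen.trans h h'

omit [Finite ι] [P.IsCrystallographic] [P.IsReduced] in
theorem BruhatStep.le {u v : weylGroup P} (h : BruhatStep b u v) : BruhatLE b u v :=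
  Relation.ReflTransGen.single h

omit [Finite ι] [P.IsCrystallographic] [P.IsReduced] in
theorem bruhatStep_mul_reflection (w : weylGroup P) (i : ι)
    (h : weylLength b w < weylLength b (w * weylReflection P i)) :
    BruhatStep b w (w * weylReflection P i) := by
  obtain ⟨k, -, hw⟩ := exists_root'_apply_eq P w i
  refine ⟨⟨k, ?_⟩, h⟩
  rw [hw]
  rfl

omit [Finite ι] [P.IsCrystallographic] [P.IsReduced] in
theorem le_bruhatUp (i : ι) (w : weylGroup P) : BruhatLE b w (bruhatUp b i w) := by
  unfold bruhatUp
  split_ifs with h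
  · exact (bruhatStep_mul_reflection w i h).le
  · exact bruhatLE_refl w

omit [Finite ι] [P.IsCrystallographic] [P.IsReduced] in
theorem mul_reflection_mul_reflection (w : weylGroup P) (i : ι) :
    w * weylReflection P i * weylReflection P i = w := by
  rw [mul_assoc, weylReflection_mul_self, mul_one]

omit [Finite ι] [P.IsCrystallographic] [P.IsReduced] in
theorem bruhatDown_le (i : ι) (w : weylGroup P) : BruhatLE b (bruhatDown b i w) w := by
  unfold bruhatDown
  split_ifs with h
  · have := (bruhatStep_mul_reflection (b := b) (w * weylReflection P i) i
      (by rwa [mul_reflection_mul_reflection])).le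
    rwa [mul_reflection_mul_reflection] at this
  · exact bruhatLE_refl w

theorem mul_le_bruhatUp [P.IsRootSystem] (i : ι) (w : weylGroup P) :
    BruhatLE b (w * weylReflection P i) (bruhatUp b i w) := by
  unfold bruhatUp
  split_ifs with h
  · exact bruhatLE_refl _
  · have := (bruhatStep_mul_reflection (b := b) (w * weylReflection P i) i (by
      rw [mul_reflection_mul_reflection]
      exact lt_of_le_of_ne (not_lt.1 h) (weylLength_mul_simple_ne b w i))).le
    rwa [mul_reflection_mul_reflection] at this

theorem bruhatDown_le_mul [P.IsRootSystem] (i : ι) (w : weylGroup P) :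
    BruhatLE b (bruhatDown b i w) (w * weylReflection P i) := by
  unfold bruhatDown
  split_ifs with h
  · exact bruhatLE_refl _
  · exact (bruhatStep_mul_reflection w i
      (lt_of_le_of_ne (not_lt.1 h) (weylLength_mul_simple_ne b w i).symm)).le

/-- For one step from `v'` to `v`, the lifting property puts both `v'` and `v' s` below the longer
of `v` and `v s`. Hence a whole chain can be moved at once inside its cosets. -/
theorem bruhatUp_mono [P.IsRootSystem] {u v : weylGroup P} (h : BruhatLE b u v) {i : ι}
    (hi : i ∈ b.support) : BruhatLE b (bruhatUp b i u) (bruhatUp b i v) := by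
  induction h with
  | refl => exact bruhatLE_refl _
  | @tail v' v _ h ih =>
    refine ih.trans ?_
    have h1 : BruhatLE b v' (bruhatUp b i v) :=
      (BruhatStep.le (b := b) h).trans (le_bruhatUp i v)
    have h2 : BruhatLE b (v' * weylReflection P i) (bruhatUp b i v) := by
      rcases bruhatStep_mul_simple b h hi with h' | h'
      · rw [h']; exact le_bruhatUp i v
      · exact h'.le.trans (mul_le_bruhatUp i v)
    rw [bruhatUp]
    split_ifs
    exacts [h2, h1]

theorem bruhatDown_mono [P.IsRootSystem] {u v : weylGroup P} (h : BruhatLE b u v) {i : ι}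
    (hi : i ∈ b.support) : BruhatLE b (bruhatDown b i u) (bruhatDown b i v) := by
  induction h with
  | refl => exact bruhatLE_refl _
  | @tail v' v _ h ih =>
    refine ih.trans ?_
    have h1 : BruhatLE b (bruhatDown b i v') v :=
      (bruhatDown_le i v').trans (BruhatStep.le (b := b) h)
    have h2 : BruhatLE b (bruhatDown b i v') (v * weylReflection P i) := by
      rcases bruhatStep_mul_simple b h hi with h' | h'
      · rw [← h', mul_reflection_mul_reflection]; exact bruhatDown_le i v'
      · exact (bruhatDown_le_mul i v').trans h'.le
    conv_rhs => rw [bruhatDown]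
    split_ifs
    exacts [h2, h1]

/-- If `t` is the longest element of its coset modulo the parabolic subgroup generated by a set of
simple reflections, then it is the largest element of the coset. -/
theorem bruhatLE_of_isMax [P.IsRootSystem] {t : weylGroup P} {l : List ι}
    (hl : ∀ i ∈ l, i ∈ b.support) (ht : ∀ i ∈ l, bruhatUp b i t = t) :
    BruhatLE b (t * weylProd P l) t := by
  induction l using List.reverseRecOn with
  | nil => simpa using bruhatLE_refl t
  | append_singleton l i ih =>
    -- Applying `bruhatUp` to the inductive bound leaves its right side `t` unchanged, while the
    -- product with one more letter lies below the left side.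
    have h := bruhatUp_mono (i := i) (ih (fun j hj => hl j (by simp [hj]))
      fun j hj => ht j (by simp [hj])) (hl i (by simp))
    rw [ht i (by simp)] at h
    rw [weylProd_append, weylProd_cons, weylProd_nil, mul_one, ← mul_assoc]
    exact (mul_le_bruhatUp i _).trans h

theorem bruhatLE_of_isMin [P.IsRootSystem] {t : weylGroup P} {l : List ι}
    (hl : ∀ i ∈ l, i ∈ b.support) (ht : ∀ i ∈ l, bruhatDown b i t = t) :
    BruhatLE b t (t * weylProd P l) := by
  induction l using List.reverseRecOn with
  | nil => simpa using bruhatLE_refl t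
  | append_singleton l i ih =>
    have h := bruhatDown_mono (i := i) (ih (fun j hj => hl j (by simp [hj]))
      fun j hj => ht j (by simp [hj])) (hl i (by simp))
    rw [ht i (by simp)] at h
    rw [weylProd_append, weylProd_cons, weylProd_nil, mul_one, ← mul_assoc]
    exact h.trans (bruhatDown_le_mul i _)

/-! ### The dominant chamber is a strict fundamental domain -/

/-- Two conjugate dominant points are equal, and the conjugating element lies in the parabolic
subgroup generated by the simple reflections fixing the point. -/
theorem eq_of_mem_dominantChamber [P.IsRootSystem] {x y : N} (hx : x ∈ dominantChamber b)
    (hy : y ∈ dominantChamber b) (w : weylGroup P) (h : (w : N ≃ₗ[ℝ] N) x = y) :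
    x = y ∧ ∃ l : List ι, (∀ i ∈ l, i ∈ b.support ∧ P.root' i x = 0) ∧ weylProd P l = w := by
  obtain ⟨p, hp⟩ := exists_isAlcoveInterior b
  induction hn : weylLength b w using Nat.strong_induction_on generalizing w with
  | _ n ih =>
    obtain ⟨l, hl, hlen, rfl⟩ := exists_reduced_word b w
    rcases List.eq_nil_or_concat l with rfl | ⟨l', i, rfl⟩
    · exact ⟨h, [], by simp, rfl⟩
    · rw [List.concat_eq_append] at *
      have hi : i ∈ b.support := hl i (by simp)
      set w' := weylProd P l' with hw'
      have hw : weylProd P (l' ++ [i]) = w' * weylReflection P i := by simp [hw']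
      rw [hw] at h hn hlen ⊢
      have hlt : weylLength b w' < n := by
        rw [← hn, ← hlen]
        refine (weylLength_le b fun j hj => hl j (by simp [hj])).trans_lt (by simp)
      -- `k` is the image of the last letter `i` under the word. It is negative since dropping `i`
      -- shortens the word; dominance of both `x` and `y` then forces `i` to vanish at `x`, so the
      -- letter fixes `x` and can be dropped.
      obtain ⟨k, hroot, hkw⟩ := exists_root'_apply_eq P (w' * weylReflection P i) i
      rw [mul_reflection_mul_reflection] at hkw
      have hkneg : ¬ b.IsPos k := fun hpos => by
        have := weylLength_lt_reflection_mul hp hpos (w := w' * weylReflection P i) (by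
          rw [hroot, hp.pos_iff]; exact RootPairing.Base.isPos_of_mem_support hi)
        rw [← hkw] at this
        omega
      have hix : P.root' i x = 0 := by
        refine le_antisymm ?_ (hx i (RootPairing.Base.isPos_of_mem_support hi))
        have := hy _ ((isPos_reflectionPerm_self b k).2 hkneg)
        rw [root'_reflectionPerm_self, ← h, hroot] at this
        linarith
      have hsx : P.coreflection i x = x := by
        rw [P.coreflection_apply, hix, zero_smul, sub_zero]
      obtain ⟨h1, l₁, h2, h3⟩ := ih _ hlt w' (by
        rw [← h, Subgroup.coe_mul, LinearEquiv.mul_apply, coe_weylReflection, hsx]) rfl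
      refine ⟨h1, l₁ ++ [i], fun j hj => ?_, by simp [h3]⟩
      rcases List.mem_append.1 hj with hj | hj
      · exact h2 j hj
      · rw [List.mem_singleton.1 hj]
        exact ⟨hi, hix⟩

end WeylGroup

/-! ### The affine Weyl group and its fundamental alcove. -/

section AffineWeylGroup

variable {ι M N : Type*} [AddCommGroup M] [Module ℝ M] [AddCommGroup N] [Module ℝ N]

theorem affineReflection_eq (P : RootPairing ι ℝ M N) (i : ι) (n : ℤ) (x : N) :
    affineReflection P i n x = P.coreflection i x - n • P.coroot i := by
  rw [affineReflection_apply, P.coreflection_apply, add_smul, Int.cast_smul_eq_zsmul]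
  abel

theorem affineReflection_affineReflection (P : RootPairing ι ℝ M N) (i : ι) (n : ℤ) (x : N) :
    affineReflection P i n (affineReflection P i n x) = x := by
  rw [affineReflection_apply, affineReflection_apply, map_sub, map_smul, P.root'_coroot_eq_pairing,
    P.pairing_same, smul_eq_mul]
  module

theorem affineReflection_mem (P : RootPairing ι ℝ M N) (i : ι) (n : ℤ) :
    affineReflection P i n ∈ affineWeylGroup P :=
  Subgroup.subset_closure ⟨(i, n), rfl⟩

theorem affineEquiv_mul_apply (g h : N ≃ᵃ[ℝ] N) (x : N) : (g * h) x = g (h x) := rfl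

theorem affineReflection_inv (P : RootPairing ι ℝ M N) (i : ι) (n : ℤ) :
    (affineReflection P i n)⁻¹ = affineReflection P i n := by
  rw [inv_eq_iff_mul_eq_one]
  ext x
  exact affineReflection_affineReflection P i n x

theorem affineWeylGroup_induction (P : RootPairing ι ℝ M N)
    {p : ∀ g, g ∈ affineWeylGroup P → Prop} (one : p 1 (one_mem _))
    (mul : ∀ i n g hg, p g hg →
      p (affineReflection P i n * g) (mul_mem (affineReflection_mem P i n) hg))
    {g : N ≃ᵃ[ℝ] N} (hg : g ∈ affineWeylGroup P) : p g hg := by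
  induction hg using Subgroup.closure_induction_left with
  | one => exact one
  | mul_left x hx y hy ih =>
    obtain ⟨⟨i, n⟩, rfl⟩ := hx
    exact mul i n y hy ih
  | inv_mul_cancel x hx y hy ih =>
    obtain ⟨⟨i, n⟩, rfl⟩ := hx
    simp only [affineReflection_inv]
    exact mul i n y hy ih

/-- The affine Weyl group permutes the affine roots. -/
theorem exists_root'_apply_affineWeylGroup (P : RootPairing ι ℝ M N) [P.IsCrystallographic]
    {g : N ≃ᵃ[ℝ] N} (hg : g ∈ affineWeylGroup P) (i : ι) (n : ℤ) :
    ∃ (j : ι) (m : ℤ), ∀ x, P.root' i (g x) + n = P.root' j x + m := by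
  induction hg using affineWeylGroup_induction generalizing i n with
  | one => exact ⟨i, n, fun _ => rfl⟩
  | mul k l g _ ih =>
    obtain ⟨j, m, h⟩ := ih (P.reflectionPerm k i) (n - l * P.pairingIn ℤ i k)
    refine ⟨j, m, fun x => ?_⟩
    rw [← h, affineEquiv_mul_apply, affineReflection_eq, map_sub, map_zsmul,
      root'_reflectionPerm, P.root'_coroot_eq_pairing, ← P.algebraMap_pairingIn ℤ]
    simp only [zsmul_eq_mul, eq_intCast, Int.cast_sub, Int.cast_mul]
    ring

/-- Coroots are closed under negation, so the submonoid they generate is already the coroot lattice.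
The submonoid form presents its elements as sums of lists of coroots. -/
theorem zsmul_coroot_mem (P : RootPairing ι ℝ M N) (i : ι) (n : ℤ) :
    n • P.coroot i ∈ AddSubmonoid.closure (range P.coroot) := by
  obtain ⟨k, rfl | rfl⟩ := n.eq_nat_or_neg
  · rw [natCast_zsmul]
    exact nsmul_mem (AddSubmonoid.subset_closure (mem_range_self i)) k
  · rw [neg_smul, natCast_zsmul, ← smul_neg]
    exact nsmul_mem (AddSubmonoid.subset_closure (P.neg_coroot_mem i)) k

theorem coreflection_mem_closure (P : RootPairing ι ℝ M N) (i : ι) {q : N}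
    (hq : q ∈ AddSubmonoid.closure (range P.coroot)) :
    P.coreflection i q ∈ AddSubmonoid.closure (range P.coroot) := by
  induction hq using AddSubmonoid.closure_induction with
  | mem x hx => exact AddSubmonoid.subset_closure (P.mapsTo_coreflection_coroot i hx)
  | zero => rw [map_zero]; exact zero_mem _
  | add x y _ _ hx hy => rw [map_add]; exact add_mem hx hy

/-- The affine Weyl group consists of products of translations by elements of the coroot lattice and
elements of the Weyl group. -/
theorem exists_weylGroup_add (P : RootPairing ι ℝ M N) {g : N ≃ᵃ[ℝ] N}
    (hg : g ∈ affineWeylGroup P) : ∃ (w : weylGroup P),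
      ∃ q ∈ AddSubmonoid.closure (range P.coroot), ∀ x, g x = (w : N ≃ₗ[ℝ] N) x + q := by
  induction hg using affineWeylGroup_induction with
  | one => exact ⟨1, 0, zero_mem _, fun x => by simp⟩
  | mul k l g _ ih =>
    obtain ⟨w, q, hq, h⟩ := ih
    refine ⟨weylReflection P k * w, P.coreflection k q + (-l) • P.coroot k,
      add_mem (coreflection_mem_closure P k hq) (zsmul_coroot_mem P k _), fun x => ?_⟩
    rw [affineEquiv_mul_apply, affineReflection_eq, h, map_add, neg_smul, Subgroup.coe_mul,
      LinearEquiv.mul_apply, coe_weylReflection]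
    abel

theorem eq_zero_of_root'_eq_zero (P : RootPairing ι ℝ M N) [P.IsRootSystem] {x : N}
    (h : ∀ i, P.root' i x = 0) : x = 0 := by
  have h1 : P.toLinearMap.flip.toPerfPair x = 0 := by
    refine LinearMap.ext_on_range (v := P.root) RootPairing.IsRootSystem.span_root_eq_top
      fun i => ?_
    simpa using h i
  exact (LinearEquiv.map_eq_zero_iff _).1 h1

/-! ### The coroot form as squared Euclidean distance. -/

section Form

variable [Fintype ι] (P : RootPairing ι ℝ M N)

theorem corootForm_nonneg (x : N) : 0 ≤ P.CorootForm x x := by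
  rw [P.corootForm_apply_apply]
  exact Finset.sum_nonneg fun i _ => mul_self_nonneg _

theorem corootForm_pos [P.IsRootSystem] {x : N} (hx : x ≠ 0) : 0 < P.CorootForm x x := by
  refine lt_of_le_of_ne (corootForm_nonneg P x) fun h => hx ?_
  rw [P.corootForm_apply_apply, eq_comm,
    Finset.sum_eq_zero_iff_of_nonneg fun i _ => mul_self_nonneg _] at h
  exact eq_zero_of_root'_eq_zero P fun i => mul_self_eq_zero.1 (h i (Finset.mem_univ i))

/-- The form identifies the coroot with a positive multiple of the root, which makes the reflections
orthogonal. -/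
theorem two_mul_corootForm_coroot [P.IsCrystallographic] (i : ι) (x : N) :
    2 * P.CorootForm (P.coroot i) x =
      P.CorootForm (P.coroot i) (P.coroot i) * P.root' i x := by
  have h := congrArg (fun y => P.toLinearMap y x) (P.corootForm_self_smul_root i)
  simp only [map_smul, LinearMap.smul_apply, map_nsmul, P.toLinearMap_apply_CoPolarization,
    smul_eq_mul, nsmul_eq_mul, Nat.cast_ofNat] at h
  exact h.symm

theorem corootForm_symm (x y : N) : P.CorootForm x y = P.CorootForm y x := by
  simp only [P.corootForm_apply_apply, mul_comm]

/-- Reflecting a point in a wall that separates it from `p` brings it closer to `p`. -/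
theorem corootForm_affineReflection_lt [P.IsRootSystem] [P.IsCrystallographic] {i : ι} {n : ℤ}
    {y p : N} (hy : P.root' i y + n < 0) (hp : 0 < P.root' i p + n) :
    P.CorootForm (affineReflection P i n y - p) (affineReflection P i n y - p) <
      P.CorootForm (y - p) (y - p) := by
  have h1 := two_mul_corootForm_coroot P i (y - p)
  have h2 : 0 < P.CorootForm (P.coroot i) (P.coroot i) := corootForm_pos P (P.ne_zero' i)
  have h3 := corootForm_symm P (y - p) (P.coroot i)
  have h5 : P.root' i (y - p) = P.root' i y + n - (P.root' i p + n) := by rw [map_sub]; ring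
  rw [affineReflection_apply]
  generalize P.root' i y + n = f at *
  have h4 : y - f • P.coroot i - p = (y - p) - f • P.coroot i := by abel
  rw [h4]
  generalize y - p = z at *
  simp only [map_sub, map_smul, LinearMap.sub_apply, LinearMap.smul_apply, smul_eq_mul, h3]
  have h6 : f * P.CorootForm (P.coroot i) (P.coroot i) * (P.root' i p + n) < 0 :=
    mul_neg_of_neg_of_pos (mul_neg_of_neg_of_pos hy h2) hp
  rw [h5] at h1
  linear_combination h6 - f * h1

/-- The distance to `p` attains its minimum on the orbit of `z` under a subset of the affine Weyl
group. -/
theorem exists_minimal_corootForm [P.IsCrystallographic] {S : Set (N ≃ᵃ[ℝ] N)}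
    (hS : S ⊆ affineWeylGroup P) (hne : S.Nonempty) (z p : N) :
    ∃ g ∈ S, ∀ h ∈ S, P.CorootForm (g z - p) (g z - p) ≤ P.CorootForm (h z - p) (h z - p) := by
  obtain ⟨g₀, hg₀⟩ := hne
  set R := P.CorootForm (g₀ z - p) (g₀ z - p) with hR
  have hR0 : 0 ≤ R := corootForm_nonneg P _
  -- On the orbit a root takes values in finitely many translates of the integers. Only finitely
  -- many of them are compatible with a distance at most `R`, and the distance is a function of
  -- these values. The bound `R + 1` serves because `t² ≤ R` implies `t² ≤ (R + 1)²`.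
  have hfin (i : ι) : {t : ℝ | (∃ (j : ι) (m : ℤ), t = P.root' j z + m - P.root' i p) ∧
      |t| ≤ R + 1}.Finite := by
    have : ∀ j : ι, ((fun m : ℤ => P.root' j z + m - P.root' i p) ''
        Icc ⌊P.root' i p - P.root' j z - (R + 1)⌋ ⌈P.root' i p - P.root' j z + (R + 1)⌉).Finite :=
      fun j => (finite_Icc _ _).image _
    refine (finite_iUnion this).subset ?_
    rintro t ⟨⟨j, m, rfl⟩, ht⟩
    rw [abs_le] at ht
    refine mem_iUnion.2 ⟨j, m, ⟨?_, ?_⟩, rfl⟩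
    · exact Int.cast_le.1 ((Int.floor_le _).trans (by linarith [ht.1] :
        P.root' i p - P.root' j z - (R + 1) ≤ m))
    · exact Int.cast_le.1 (le_trans (by linarith [ht.2] :
        (m : ℝ) ≤ P.root' i p - P.root' j z + (R + 1)) (Int.le_ceil _))
  have hV : ((fun g : N ≃ᵃ[ℝ] N => P.CorootForm (g z - p) (g z - p)) '' S ∩ Iic R).Finite := by
    refine ((Set.Finite.pi hfin).image fun t => ∑ i, t i * t i).subset ?_
    rintro _ ⟨⟨g, hg, rfl⟩, hle⟩
    refine ⟨fun i => P.root' i (g z - p), fun i _ => ⟨?_, ?_⟩, (P.corootForm_apply_apply _ _).symm⟩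
    · obtain ⟨j, m, h⟩ := exists_root'_apply_affineWeylGroup P (hS hg) i 0
      refine ⟨j, m, ?_⟩
      simp only [map_sub, ← h, Int.cast_zero, add_zero]
    · have h1 : P.root' i (g z - p) * P.root' i (g z - p) ≤ R := by
        refine le_trans ?_ hle
        simp only [P.corootForm_apply_apply]
        exact Finset.single_le_sum (f := fun i => P.root' i (g z - p) * P.root' i (g z - p))
          (fun i _ => mul_self_nonneg _) (Finset.mem_univ i)
      refine abs_le_of_sq_le_sq ?_ (by linarith)
      nlinarith
  obtain ⟨_, ⟨⟨g, hg, rfl⟩, hgR⟩, hmin⟩ := hV.exists_minimal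
    ⟨R, ⟨g₀, hg₀, rfl⟩, le_refl R⟩
  refine ⟨g, hg, fun h hh => ?_⟩
  by_contra hlt
  rw [not_le] at hlt
  exact hlt.not_ge (hmin ⟨⟨h, hh, rfl⟩, hlt.le.trans hgR⟩ hlt.le)

end Form

section CorootLattice

variable (P : RootPairing ι ℝ M N) [Finite ι] [P.IsRootSystem] [P.IsCrystallographic]

/-- An element of the coroot lattice on which all roots take values in `{-1, 0, 1}` vanishes. -/
theorem eq_zero_of_mem_corootLattice {q : N} (hq : q ∈ AddSubmonoid.closure (range P.coroot))
    (h : ∀ i, P.root' i q ≤ 1) : q = 0 := by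
  cases nonempty_fintype ι
  obtain ⟨l, hl, rfl⟩ := AddSubmonoid.exists_list_of_mem_closure hq
  generalize hn : l.length = n
  generalize hs : l.sum = s at *
  induction n using Nat.strong_induction_on generalizing l with
  | _ n ih =>
    by_contra hs0
    -- Induction on the number of coroots in the sum. As the form is positive at `(s, s)`, it is
    -- positive at `(s, c)` for some summand `c`.
    have h1 : ∃ c ∈ l, 0 < P.CorootForm s c := by
      by_contra! hc
      have h2 : P.CorootForm s s ≤ 0 := by
        have h3 : P.CorootForm s s = (l.map (P.CorootForm s)).sum := by rw [← map_list_sum, hs]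
        rw [h3]
        refine (List.sum_le_card_nsmul _ 0 fun y hy => ?_).trans_eq (smul_zero _)
        obtain ⟨c, hc', rfl⟩ := List.mem_map.1 hy
        exact hc c hc'
      exact absurd (corootForm_pos P hs0) h2.not_gt
    obtain ⟨c, hc, hpos⟩ := h1
    obtain ⟨i, rfl⟩ := hl c hc
    have h2 : 0 < P.root' i s := by
      have h3 := two_mul_corootForm_coroot P i s
      rw [corootForm_symm] at h3
      have h4 := corootForm_nonneg P (P.coroot i)
      by_contra! h5
      nlinarith
    obtain ⟨l₁, hl₁⟩ : ∃ l₁, l.Perm (P.coroot i :: l₁) := by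
      classical exact ⟨_, List.perm_cons_erase hc⟩
    -- The summand `coroot i` alone contributes 2 to a value that is at most 1, so another summand
    -- contributes negatively.
    have h3 : ∃ c ∈ l₁, P.root' i c < 0 := by
      by_contra! hc'
      have h4 : P.root' i s = 2 + (l₁.map (P.root' i)).sum := by
        rw [← hs, hl₁.sum_eq, List.sum_cons, map_add, map_list_sum, P.root'_coroot_eq_pairing,
          P.pairing_same]
      have h5 : 0 ≤ (l₁.map (P.root' i)).sum := by
        refine List.sum_nonneg fun y hy => ?_
        obtain ⟨c, hc'', rfl⟩ := List.mem_map.1 hy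
        exact hc' c hc''
      linarith [h i]
    obtain ⟨c', hc', hneg⟩ := h3
    obtain ⟨j, rfl⟩ := hl c' (hl₁.mem_iff.2 (by simp [hc']))
    obtain ⟨l₂, hl₂⟩ : ∃ l₂, l₁.Perm (P.coroot j :: l₂) := by
      classical exact ⟨_, List.perm_cons_erase hc'⟩
    have hmem : ∀ y ∈ l₂, y ∈ range P.coroot := fun y hy =>
      hl y (hl₁.mem_iff.2 (List.mem_cons_of_mem _ (hl₂.mem_iff.2 (List.mem_cons_of_mem _ hy))))
    have hlen : n = l₂.length + 2 := by
      rw [← hn, hl₁.length_eq, List.length_cons, hl₂.length_eq, List.length_cons]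
    have hsum : s = P.coroot j + P.coroot i + l₂.sum := by
      rw [← hs, hl₁.sum_eq, List.sum_cons, hl₂.sum_eq, List.sum_cons]
      abel
    -- Two coroots with negative pairing add up to zero or to a coroot, which shortens the list.
    by_cases hij : P.coroot j = -P.coroot i
    · exact hs0 (ih _ (by omega) l₂ hmem rfl (by rw [hsum, hij]; abel))
    · have hneg' : P.flip.pairingIn ℤ j i < 0 := by
        have : (P.pairingIn ℤ i j : ℝ) < 0 := by
          rwa [P.root'_coroot_eq_pairing, ← P.algebraMap_pairingIn ℤ] at hneg
        exact_mod_cast this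
      obtain ⟨k, hk⟩ := P.flip.root_add_root_mem_of_pairingIn_neg hneg' hij
      refine hs0 (ih _ ?_ (P.coroot k :: l₂) ?_ rfl ?_)
      · rw [List.length_cons]; omega
      · simpa using hmem
      · rw [List.sum_cons, hsum]
        congr 1

end CorootLattice

variable {P : RootPairing ι ℝ M N} {b : P.Base}

/-- A positive root has values in `[0, 1]` on the alcove, and no integer lies strictly inside;
negative roots follow by a change of sign. -/
theorem alcove_subset_half [Finite ι] (i : ι) (n : ℤ) :
    (∀ a ∈ fundamentalAlcove b, 0 ≤ P.root' i a + n) ∨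
      (∀ a ∈ fundamentalAlcove b, P.root' i a + n ≤ 0) := by
  by_cases hi : b.IsPos i
  · rcases le_or_gt 0 n with hn | hn
    · have : (0 : ℝ) ≤ n := by exact_mod_cast hn
      exact Or.inl fun a ha => by linarith [(ha i hi).1]
    · have : (n : ℝ) ≤ -1 := by exact_mod_cast Int.le_sub_one_of_lt hn
      exact Or.inr fun a ha => by linarith [(ha i hi).2]
  · have hi' := (isPos_reflectionPerm_self b i).2 hi
    rcases le_or_gt n 0 with hn | hn
    · have : (n : ℝ) ≤ 0 := by exact_mod_cast hn
      refine Or.inr fun a ha => ?_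
      have := (ha _ hi').1
      rw [root'_reflectionPerm_self] at this
      linarith
    · have : (1 : ℝ) ≤ n := by exact_mod_cast hn
      refine Or.inl fun a ha => ?_
      have := (ha _ hi').2
      rw [root'_reflectionPerm_self] at this
      linarith

theorem IsAlcoveInterior.mem {p : N} (hp : IsAlcoveInterior b p) : p ∈ fundamentalAlcove b :=
  fun i hi => ⟨(hp i hi).1.le, (hp i hi).2.le⟩

theorem IsAlcoveInterior.nonneg {p : N} (hp : IsAlcoveInterior b p) {i : ι} {n : ℤ} [Finite ι]
    (h : 0 < P.root' i p + n) : ∀ a ∈ fundamentalAlcove b, 0 ≤ P.root' i a + n :=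
  (alcove_subset_half i n).resolve_right fun h' => (h' p hp.mem).not_gt h

theorem IsAlcoveInterior.nonpos {p : N} (hp : IsAlcoveInterior b p) {i : ι} {n : ℤ} [Finite ι]
    (h : P.root' i p + n < 0) : ∀ a ∈ fundamentalAlcove b, P.root' i a + n ≤ 0 :=
  (alcove_subset_half i n).resolve_left fun h' => (h' p hp.mem).not_gt h

theorem IsAlcoveInterior.add_ne_zero {p : N} (hp : IsAlcoveInterior b p) (i : ι) (n : ℤ) :
    P.root' i p + n ≠ 0 := by
  have key (j : ι) (hj : b.IsPos j) (m : ℤ) : P.root' j p + m ≠ 0 := fun h => by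
    obtain ⟨h1, h2⟩ := hp j hj
    have h3 : (-1 : ℝ) < m := by linarith
    have h4 : (m : ℝ) < 0 := by linarith
    norm_cast at h3 h4
    omega
  by_cases hi : b.IsPos i
  · exact key i hi n
  · have := key _ ((isPos_reflectionPerm_self b i).2 hi) (-n)
    rw [root'_reflectionPerm_self] at this
    contrapose! this
    push_cast
    linarith

theorem IsAlcoveInterior.exists_separating {p y : N} (hp : IsAlcoveInterior b p)
    (hy : y ∉ fundamentalAlcove b) :
    ∃ (i : ι) (n : ℤ), P.root' i y + n < 0 ∧ 0 < P.root' i p + n := by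
  simp only [fundamentalAlcove, mem_ofPred_eq, not_forall, not_and_or, not_le] at hy
  obtain ⟨i, hi, hy | hy⟩ := hy
  · exact ⟨i, 0, by simpa using hy, by simpa using (hp i hi).1⟩
  · refine ⟨P.reflectionPerm i i, 1, ?_, ?_⟩ <;> rw [root'_reflectionPerm_self] <;> push_cast
    · linarith
    · linarith [(hp i hi).2]

variable [Finite ι] [P.IsRootSystem] [P.IsCrystallographic]

variable (b) in
/-- Every point is conjugate to a point of the fundamental alcove. -/
theorem exists_apply_mem_fundamentalAlcove (x : N) :
    ∃ g ∈ affineWeylGroup P, g x ∈ fundamentalAlcove b := by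
  cases nonempty_fintype ι
  obtain ⟨p, hp⟩ := exists_isAlcoveInterior b
  obtain ⟨g, hg, hmin⟩ := exists_minimal_corootForm P (S := affineWeylGroup P) subset_rfl
    ⟨1, one_mem _⟩ x p
  refine ⟨g, hg, ?_⟩
  by_contra hy
  obtain ⟨i, n, h1, h2⟩ := hp.exists_separating hy
  exact (hmin _ (mul_mem (affineReflection_mem P i n) hg)).not_gt
    (corootForm_affineReflection_lt P h1 h2)

-- The descent used for the alcove, restricted to the linear elements of the affine Weyl group and
-- to walls through the origin.
variable (b) in
theorem exists_apply_mem_dominantChamber (x : N) :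
    ∃ w : weylGroup P, (w : N ≃ₗ[ℝ] N) x ∈ dominantChamber b := by
  cases nonempty_fintype ι
  obtain ⟨p, hp⟩ := exists_isAlcoveInterior b
  obtain ⟨g, ⟨hg, w, hw⟩, hmin⟩ := exists_minimal_corootForm P
    (S := {g | g ∈ affineWeylGroup P ∧ ∃ w : weylGroup P, ∀ x, g x = (w : N ≃ₗ[ℝ] N) x})
    (fun g hg => hg.1) ⟨1, one_mem _, 1, fun _ => rfl⟩ x p
  refine ⟨w, fun i hi => ?_⟩
  by_contra! hneg
  refine (hmin (affineReflection P i 0 * g) ⟨mul_mem (affineReflection_mem P i 0) hg,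
    weylReflection P i * w, fun x => ?_⟩).not_gt
    (corootForm_affineReflection_lt P (by simpa [hw] using hneg) (by simpa using (hp i hi).1))
  rw [affineEquiv_mul_apply, affineReflection_eq, hw, zero_smul, sub_zero]
  rfl

variable [P.IsReduced]

/-- The fundamental alcove is a strict fundamental domain for the affine Weyl group. -/
theorem eq_of_mem_fundamentalAlcove {g : N ≃ᵃ[ℝ] N} (hg : g ∈ affineWeylGroup P) {x : N}
    (hx : x ∈ fundamentalAlcove b) (hgx : g x ∈ fundamentalAlcove b) : g x = x := by
  cases nonempty_fintype ι
  obtain ⟨p, hp⟩ := exists_isAlcoveInterior b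
  -- Among the elements agreeing with `g` at `x`, take one that moves `p` least; it will turn out to
  -- preserve the alcove.
  obtain ⟨h, ⟨hh, hhx⟩, hmin⟩ := exists_minimal_corootForm P
    (S := {h | h ∈ affineWeylGroup P ∧ h x = g x}) (fun g hg => hg.1) ⟨g, hg, rfl⟩ p p
  rw [← hhx] at hgx hmin ⊢
  have hhp : h p ∈ fundamentalAlcove b := by
    by_contra hy
    obtain ⟨i, n, h1, h2⟩ := hp.exists_separating hy
    obtain ⟨j, m, hjm⟩ := exists_root'_apply_affineWeylGroup P hh i n
    -- The wall has the alcove on one side and its image under `h` on the other. The point `h x`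
    -- belongs to both, so it lies on the wall and is unaffected by the reflection, which
    -- contradicts minimality.
    have h3 : P.root' i (h x) + n = 0 := by
      refine le_antisymm ?_ (hp.nonneg h2 _ hgx)
      rw [hjm] at h1 ⊢
      exact hp.nonpos h1 x hx
    refine (hmin (affineReflection P i n * h)
      ⟨mul_mem (affineReflection_mem P i n) hh, ?_⟩).not_gt (corootForm_affineReflection_lt P h1 h2)
    rw [affineEquiv_mul_apply, affineReflection_apply, h3, zero_smul, sub_zero]
  obtain ⟨w, q, hq, hwq⟩ := exists_weylGroup_add P hh
  -- The translation part `q = h 0` is a coroot lattice point of the alcove, hence zero. Then `h` is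
  -- linear and the result for the dominant chamber applies.
  have hq0 : h 0 ∈ fundamentalAlcove b := by
    have h0 : (0 : N) ∈ fundamentalAlcove b := fun i _ => by simp
    by_contra hy
    obtain ⟨i, n, h1, h2⟩ := hp.exists_separating hy
    obtain ⟨j, m, hjm⟩ := exists_root'_apply_affineWeylGroup P hh i n
    have h3 := hp.nonneg h2 _ hhp
    rw [hjm] at h1 h3
    exact (hp.nonneg (lt_of_le_of_ne h3 (hp.add_ne_zero j m).symm) 0 h0).not_gt h1
  have hq' : q = 0 := by
    refine eq_zero_of_mem_corootLattice P hq fun i => ?_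
    rw [hwq, map_zero, zero_add] at hq0
    by_cases hi : b.IsPos i
    · exact (hq0 i hi).2
    · have := (hq0 _ ((isPos_reflectionPerm_self b i).2 hi)).1
      rw [root'_reflectionPerm_self] at this
      linarith
  have hdom {z : N} (hz : z ∈ fundamentalAlcove b) : z ∈ dominantChamber b :=
    fun i hi => (hz i hi).1
  rw [hwq, hq', add_zero] at hgx ⊢
  exact (eq_of_mem_dominantChamber (hdom hx) (hdom hgx) w rfl).1.symm

end AffineWeylGroup

/-! ### Faces of the alcove and their types. -/

section Faces

variable {ι M N : Type*} [AddCommGroup M] [Module ℝ M] [AddCommGroup N] [Module ℝ N]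

theorem mem_faceOf_self (P : RootPairing ι ℝ M N) (x : N) : x ∈ faceOf P x := fun _ _ h => h

theorem eq_zero_of_mem_faceOf {P : RootPairing ι ℝ M N} {x y : N} (hy : y ∈ faceOf P x) {i : ι}
    {n : ℤ} (hx : P.root' i x + n = 0) : P.root' i y + n = 0 := by
  refine le_antisymm ?_ (hy i n hx.ge)
  have h := hy (P.reflectionPerm i i) (-n) (by
    simp only [posHalf, mem_ofPred_eq, root'_reflectionPerm_self]
    push_cast
    linarith)
  simp only [posHalf, mem_ofPred_eq, root'_reflectionPerm_self] at h
  push_cast at h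
  linarith

theorem faceOf_subset_wall_iff {P : RootPairing ι ℝ M N} {x : N} {i : ι} {n : ℤ} :
    faceOf P x ⊆ wall P i n ↔ x ∈ wall P i n :=
  ⟨fun h => h (mem_faceOf_self P x), fun h _ hy => eq_zero_of_mem_faceOf hy h⟩

theorem faceOf_subset_fundamentalAlcove {P : RootPairing ι ℝ M N} {b : P.Base} {x : N}
    (hx : x ∈ fundamentalAlcove b) : faceOf P x ⊆ fundamentalAlcove b := by
  intro y hy i hi
  refine ⟨by simpa [posHalf] using hy i 0 (by simpa [posHalf] using (hx i hi).1), ?_⟩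
  have := hy (P.reflectionPerm i i) 1 (by
    simp only [posHalf, mem_ofPred_eq, root'_reflectionPerm_self]
    push_cast
    linarith [(hx i hi).2])
  simp only [posHalf, mem_ofPred_eq, root'_reflectionPerm_self] at this
  push_cast at this
  linarith

theorem image_faceOf {P : RootPairing ι ℝ M N} [P.IsCrystallographic] {g : N ≃ᵃ[ℝ] N}
    (hg : g ∈ affineWeylGroup P) (x : N) : g '' faceOf P x = faceOf P (g x) := by
  have key {g : N ≃ᵃ[ℝ] N} (hg : g ∈ affineWeylGroup P) (x : N) :
      g '' faceOf P x ⊆ faceOf P (g x) := by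
    rintro _ ⟨y, hy, rfl⟩ i n h
    obtain ⟨j, m, hjm⟩ := exists_root'_apply_affineWeylGroup P hg i n
    simp only [posHalf, mem_ofPred_eq, hjm] at h ⊢
    exact hy j m h
  refine (key hg x).antisymm fun y hy => ⟨g⁻¹ y, ?_, g.apply_symm_apply y⟩
  have h := key (inv_mem hg) (g x) ⟨y, hy, rfl⟩
  rwa [show g⁻¹ (g x) = x from g.symm_apply_apply x] at h

/-- Strict constraints survive a small move by continuity, the others because `v` does not decrease
them; finiteness gives a common `ε`. -/
theorem exists_pos_add_smul {P : RootPairing ι ℝ M N} {T : Set (ι × ℤ)} (hT : T.Finite) (x v : N)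
    (h : ∀ p ∈ T, 0 < P.root' p.1 x + p.2 ∨ 0 ≤ P.root' p.1 x + p.2 ∧ 0 ≤ P.root' p.1 v) :
    ∃ ε : ℝ, 0 < ε ∧ ∀ p ∈ T, 0 ≤ P.root' p.1 (x + ε • v) + p.2 := by
  have key : ∀ᶠ ε : ℝ in nhdsWithin 0 (Ioi 0), ∀ p ∈ T, 0 ≤ P.root' p.1 (x + ε • v) + p.2 := by
    rw [Filter.eventually_all_finite hT]
    intro p hp
    simp only [map_add, map_smul, smul_eq_mul]
    rcases h p hp with h | ⟨h1, h2⟩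
    · have : Filter.Tendsto (fun ε : ℝ => P.root' p.1 x + ε * P.root' p.1 v + p.2)
          (nhdsWithin 0 (Ioi 0)) (nhds (P.root' p.1 x + 0 * P.root' p.1 v + p.2)) :=
        (Continuous.tendsto (by fun_prop) _).mono_left nhdsWithin_le_nhds
      rw [zero_mul, add_zero] at this
      exact (this.eventually_const_lt h).mono fun _ h => h.le
    · filter_upwards [self_mem_nhdsWithin] with ε hε
      have := mul_nonneg (le_of_lt hε) h2
      linarith
  obtain ⟨ε, h1, h2⟩ := (key.and self_mem_nhdsWithin).exists
  exact ⟨ε, h2, h1⟩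

variable {P : RootPairing ι ℝ M N} [Finite ι]

section

variable [P.IsRootSystem] (b : P.Base)

/-- A member of an irredundant system of inequalities describing the fundamental alcove defines a
face of codimension one. -/
theorem mem_simpleAffineRoots_of_irredundant {T : Set (ι × ℤ)} (hT : T.Finite)
    (hA : fundamentalAlcove b = {x | ∀ p ∈ T, 0 ≤ P.root' p.1 x + p.2}) {a : ι × ℤ} {x : N}
    (hxa : P.root' a.1 x + a.2 = 0) (hx : ∀ p ∈ T, p ≠ a → 0 < P.root' p.1 x + p.2) :
    a ∈ simpleAffineRoots b := by
  -- `x` can move a little in every direction parallel to the wall without leaving the facet. Thus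
  -- it is a relatively interior point, and the facet spans the kernel of the root.
  have hmem (v : N) (hv : P.root' a.1 v = 0) : ∃ ε : ℝ, 0 < ε ∧
      x + ε • v ∈ fundamentalAlcove b ∩ wall P a.1 a.2 := by
    obtain ⟨ε, h1, h2⟩ := exists_pos_add_smul (P := P) hT x v fun p hp => by
      by_cases hpa : p = a
      · rw [hpa]; exact Or.inr ⟨hxa.ge, hv.ge⟩
      · exact Or.inl (hx p hp hpa)
    refine ⟨ε, h1, by rw [hA]; exact h2, ?_⟩
    simp [wall, hv, hxa]
  have hxA : x ∈ fundamentalAlcove b ∩ wall P a.1 a.2 := by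
    obtain ⟨ε, -, h⟩ := hmem 0 (map_zero _)
    simpa using h
  refine ⟨⟨x, Subset.antisymm (fun y hy i n hin => ?_) fun y hy =>
    ⟨faceOf_subset_fundamentalAlcove hxA.1 hy, eq_zero_of_mem_faceOf hy hxa⟩⟩, ?_⟩
  · rcases alcove_subset_half (b := b) i n with h | h
    · exact h y hy.1
    · have hx0 : P.root' i x + n = 0 := le_antisymm (h x hxA.1) hin
      have hya : P.root' a.1 y + a.2 = 0 := hy.2
      -- Were the affine root negative at `y`, prolonging the segment from `y` beyond `x` would make
      -- it positive inside the alcove.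
      obtain ⟨ε, hε, h'⟩ := hmem (x - y) (by rw [map_sub]; linarith)
      have := h _ h'.1
      rw [map_add, map_smul, map_sub, smul_eq_mul] at this
      simp only [posHalf, mem_ofPred_eq]
      by_contra! hlt
      have : 0 < ε * (P.root' i x - P.root' i y) := mul_pos hε (by linarith)
      linarith
  · have : Module.Finite ℝ N := Module.Finite.of_basis b.toCoweightBasis
    have hspan : vectorSpan ℝ (fundamentalAlcove b ∩ wall P a.1 a.2) =
        LinearMap.ker (P.root' a.1) := by
      apply le_antisymm
      · rw [vectorSpan, Submodule.span_le]
        rintro _ ⟨y, hy, z, hz, rfl⟩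
        have hy' : P.root' a.1 y + a.2 = 0 := hy.2
        have hz' : P.root' a.1 z + a.2 = 0 := hz.2
        simp only [SetLike.mem_coe, LinearMap.mem_ker, vsub_eq_sub, map_sub]
        linarith
      · intro v hv
        obtain ⟨ε, hε, h⟩ := hmem v hv
        have h1 := vsub_mem_vectorSpan ℝ h hxA
        rw [vsub_eq_sub, add_sub_cancel_left] at h1
        exact (Submodule.smul_mem_iff _ hε.ne').1 h1
    rw [hspan]
    refine Module.Dual.finrank_ker_add_one_of_ne_zero fun h => ?_
    have := P.root'_coroot_eq_pairing a.1 a.1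
    rw [h, P.pairing_same] at this
    simp at this

variable [P.IsCrystallographic]

/-- The fundamental alcove is the intersection of the half-spaces belonging to its facets. -/
theorem exists_fundamentalAlcove_eq : ∃ T : Set (ι × ℤ), T.Finite ∧ T ⊆ simpleAffineRoots b ∧
    fundamentalAlcove b = {x | ∀ p ∈ T, 0 ≤ P.root' p.1 x + p.2} := by
  classical
  set T₀ : Set (ι × ℤ) := {p | b.IsPos p.1 ∧ p.2 = 0 ∨ ¬ b.IsPos p.1 ∧ p.2 = 1} with hT₀
  have hfin : T₀.Finite := by
    refine ((finite_univ (α := ι)).prod (finite_Icc (0 : ℤ) 1)).subset fun p hp => ⟨mem_univ _, ?_⟩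
    rcases hp with ⟨-, hp⟩ | ⟨-, hp⟩ <;> simp [hp]
  have hA₀ : fundamentalAlcove b = {x | ∀ p ∈ T₀, 0 ≤ P.root' p.1 x + p.2} := by
    ext x
    refine ⟨fun hx p hp => ?_, fun hx i hi => ⟨?_, ?_⟩⟩
    · rcases hp with ⟨h1, h2⟩ | ⟨h1, h2⟩
      · rw [h2, Int.cast_zero, add_zero]
        exact (hx _ h1).1
      · have := (hx _ ((isPos_reflectionPerm_self b _).2 h1)).2
        rw [root'_reflectionPerm_self] at this
        rw [h2, Int.cast_one]
        linarith
    · simpa using hx (i, 0) (Or.inl ⟨hi, rfl⟩)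
    · have := hx (P.reflectionPerm i i, 1) (Or.inr ⟨by
        rw [isPos_reflectionPerm_self, not_not]; exact hi, rfl⟩)
      simp only [root'_reflectionPerm_self, Int.cast_one] at this
      linarith
  -- In a minimal subsystem every inequality `a` is violated by some `z` satisfying all the others;
  -- this yields the relatively interior point of the facet of `a`.
  obtain ⟨T, ⟨hTT₀, hAT⟩, hmin⟩ := Set.Finite.exists_minimal
    (s := {T | T ⊆ T₀ ∧ fundamentalAlcove b = {x | ∀ p ∈ T, 0 ≤ P.root' p.1 x + p.2}})
    (hfin.finite_subsets.subset fun T hT => hT.1) ⟨T₀, subset_rfl, hA₀⟩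
  have hT := hfin.subset hTT₀
  refine ⟨T, hT, fun a ha => ?_, hAT⟩
  have hne : fundamentalAlcove b ≠ {x | ∀ p ∈ T \ {a}, 0 ≤ P.root' p.1 x + p.2} := fun h =>
    (hmin ⟨sdiff_subset.trans hTT₀, h⟩ sdiff_subset ha).2 rfl
  obtain ⟨z, hz, hzA⟩ : ∃ z, (∀ p ∈ T \ {a}, 0 ≤ P.root' p.1 z + p.2) ∧
      z ∉ fundamentalAlcove b := by
    by_contra! h
    refine hne (Subset.antisymm (fun x hx p hp => ?_) h)
    rw [hAT] at hx
    exact hx p hp.1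
  have hza : P.root' a.1 z + a.2 < 0 := by
    by_contra! h
    refine hzA ?_
    rw [hAT]
    intro p hp
    by_cases hpa : p = a
    · rw [hpa]; exact h
    · exact hz p ⟨hp, hpa⟩
  obtain ⟨p₀, hp₀⟩ := exists_isAlcoveInterior b
  have hpos (p : ι × ℤ) (hp : p ∈ T) : 0 < P.root' p.1 p₀ + p.2 := by
    have h := hp₀.mem
    rw [hAT] at h
    exact lt_of_le_of_ne (h p hp) (hp₀.add_ne_zero p.1 p.2).symm
  have hpa := hpos a ha
  set d := (P.root' a.1 p₀ + a.2) - (P.root' a.1 z + a.2) with hd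
  have hd0 : 0 < d := by linarith
  -- The point where the segment from `p₀` to `z` meets the wall of `a`, written as a convex
  -- combination. The other constraints are positive at `p₀` and nonnegative at `z`, hence positive
  -- there.
  have hcomb (p : ι × ℤ) : P.root' p.1 (p₀ + ((P.root' a.1 p₀ + a.2) / d) • (z - p₀)) + p.2 =
      (-(P.root' a.1 z + a.2) / d) * (P.root' p.1 p₀ + p.2) +
        ((P.root' a.1 p₀ + a.2) / d) * (P.root' p.1 z + p.2) := by
    simp only [map_add, map_smul, map_sub, smul_eq_mul]
    have : -(P.root' a.1 z + a.2) / d = 1 - (P.root' a.1 p₀ + a.2) / d := by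
      field_simp
      rw [hd]
      ring
    rw [this]
    ring
  refine mem_simpleAffineRoots_of_irredundant b hT hAT
    (x := p₀ + ((P.root' a.1 p₀ + a.2) / d) • (z - p₀)) ?_ fun p hp hne' => ?_
  · rw [hcomb]
    ring
  · rw [hcomb]
    have h1 : 0 < -(P.root' a.1 z + a.2) / d := div_pos (by linarith) hd0
    have h2 : 0 < (P.root' a.1 p₀ + a.2) / d := div_pos hpa hd0
    have h3 := mul_pos h1 (hpos p hp)
    have h4 := mul_nonneg h2.le (hz p ⟨hp, hne'⟩)
    linarith

variable {b}

/-- A face of the fundamental alcove is determined by the facets containing it. -/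
theorem faceOf_subset_of_walls {x y : N} (hx : x ∈ fundamentalAlcove b)
    (hy : y ∈ fundamentalAlcove b)
    (h : ∀ p ∈ simpleAffineRoots b, x ∈ wall P p.1 p.2 → y ∈ wall P p.1 p.2) :
    faceOf P y ⊆ faceOf P x := by
  obtain ⟨T, hT, hTs, hA⟩ := exists_fundamentalAlcove_eq b
  -- All facet walls through `x` contain `y`, so the segment from `y` to `x` can be prolonged beyond
  -- `x` inside the alcove.
  obtain ⟨ε, hε, hmem⟩ := exists_pos_add_smul (P := P) hT x (x - y) fun p hp => by
    have hx' := hx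
    rw [hA] at hx'
    rcases (hx' p hp).eq_or_lt with h0 | h0
    · refine Or.inr ⟨h0.le, ?_⟩
      have : P.root' p.1 y + p.2 = 0 := h p (hTs hp) h0.symm
      rw [map_sub]
      linarith
    · exact Or.inl h0
  have hmem' : x + ε • (x - y) ∈ fundamentalAlcove b := by rw [hA]; exact hmem
  intro z hz i n hin
  refine hz i n ?_
  rcases alcove_subset_half (b := b) i n with h' | h'
  · exact h' y hy
  · have hx0 : P.root' i x + n = 0 := le_antisymm (h' x hx) hin
    have := h' _ hmem'
    rw [map_add, map_smul, map_sub, smul_eq_mul] at this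
    simp only [posHalf, mem_ofPred_eq]
    by_contra! hlt
    have : 0 < ε * (P.root' i x - P.root' i y) := mul_pos hε (by linarith)
    linarith

theorem faceOf_eq_of_walls {x y : N} (hx : x ∈ fundamentalAlcove b) (hy : y ∈ fundamentalAlcove b)
    (h : ∀ p ∈ simpleAffineRoots b, x ∈ wall P p.1 p.2 ↔ y ∈ wall P p.1 p.2) :
    faceOf P x = faceOf P y :=
  (faceOf_subset_of_walls hy hx fun p hp => (h p hp).2).antisymm
    (faceOf_subset_of_walls hx hy fun p hp => (h p hp).1)

variable [P.IsReduced]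

/-- Points of the alcove are conjugate only to themselves, so the conjugate face quantified over in
`faceType` passes through `x` whichever conjugating element is chosen. -/
theorem faceType_image_faceOf {g : N ≃ᵃ[ℝ] N} (hg : g ∈ affineWeylGroup P) {x : N}
    (hx : x ∈ fundamentalAlcove b) :
    faceType b (g '' faceOf P x) = {p | p ∈ simpleAffineRoots b ∧ x ∈ wall P p.1 p.2} := by
  ext p
  refine and_congr_right fun hp => ⟨?_, fun h => ⟨faceOf P x, ⟨x, rfl⟩,
    faceOf_subset_fundamentalAlcove hx, ⟨g, hg, rfl⟩, faceOf_subset_wall_iff.2 h⟩⟩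
  rintro ⟨F, -, hFA, ⟨w, hw, hwF⟩, hFp⟩
  obtain ⟨z, hz, hzx⟩ : g x ∈ w '' F := by rw [hwF]; exact ⟨x, mem_faceOf_self P x, rfl⟩
  have h1 : (g⁻¹ * w) z = x := by
    rw [affineEquiv_mul_apply, hzx]
    exact g.symm_apply_apply x
  have h2 := eq_of_mem_fundamentalAlcove (mul_mem (inv_mem hg) hw) (hFA hz) (by rwa [h1])
  rw [← h1, h2]
  exact hFp hz

/-- Types identify the faces once they are moved into the alcove. An element moving the edge there
also moves its vertex there, so a single `g` serves both. -/
theorem exists_image_eq_of_faceType_eq {x y v v' : N} (hv : IsVertex P v) (hv' : IsVertex P v')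
    (hvx : v ∈ faceOf P x) (hvy : v' ∈ faceOf P y)
    (hxy : faceType b (faceOf P x) = faceType b (faceOf P y))
    (hvv : faceType b {v} = faceType b {v'}) :
    ∃ g ∈ affineWeylGroup P, g '' faceOf P y = faceOf P x ∧ g v' = v := by
  have hvert {v : N} (hv : IsVertex P v) : {v} = faceOf P v := by
    obtain ⟨z, hz⟩ := hv
    have : z = v := by simpa [← hz] using mem_faceOf_self P z
    rw [hz, this]
  have htype (x g) (hg : g ∈ affineWeylGroup P) (hx : g x ∈ fundamentalAlcove b) :
      faceType b (faceOf P x) = {p | p ∈ simpleAffineRoots b ∧ g x ∈ wall P p.1 p.2} := by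
    rw [← faceType_image_faceOf (inv_mem hg) hx, image_faceOf (inv_mem hg)]
    congr 2
    exact (g.symm_apply_apply x).symm
  have key {x y : N} {g h : N ≃ᵃ[ℝ] N} (hg : g ∈ affineWeylGroup P) (hh : h ∈ affineWeylGroup P)
      (hx : g x ∈ fundamentalAlcove b) (hy : h y ∈ fundamentalAlcove b)
      (hxy : faceType b (faceOf P x) = faceType b (faceOf P y)) :
      faceOf P (g x) = faceOf P (h y) := by
    rw [htype x g hg hx, htype y h hh hy] at hxy
    refine faceOf_eq_of_walls hx hy fun p hp => ?_
    have := Set.ext_iff.1 hxy p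
    simpa [hp] using this
  obtain ⟨g, hg, hgx⟩ := exists_apply_mem_fundamentalAlcove b x
  obtain ⟨h, hh, hhy⟩ := exists_apply_mem_fundamentalAlcove b y
  have hgv : g v ∈ fundamentalAlcove b :=
    faceOf_subset_fundamentalAlcove hgx (by rw [← image_faceOf hg]; exact ⟨v, hvx, rfl⟩)
  have hhv : h v' ∈ fundamentalAlcove b :=
    faceOf_subset_fundamentalAlcove hhy (by rw [← image_faceOf hh]; exact ⟨v', hvy, rfl⟩)
  refine ⟨g⁻¹ * h, mul_mem (inv_mem hg) hh, ?_, ?_⟩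
  · rw [image_faceOf (mul_mem (inv_mem hg) hh), affineEquiv_mul_apply, ← image_faceOf (inv_mem hg),
      ← key hg hh hgx hhy hxy, image_faceOf (inv_mem hg)]
    congr 1
    exact g.symm_apply_apply x
  · rw [hvert hv, hvert hv'] at hvv
    have h1 := key hg hh hgv hhv hvv
    rw [← image_faceOf hg, ← image_faceOf hh, ← hvert hv, ← hvert hv', image_singleton,
      image_singleton, singleton_eq_singleton_iff] at h1
    rw [affineEquiv_mul_apply, ← h1]
    exact g.symm_apply_apply v

end

end Faces

/-! ### The edges of the gallery of a dominant coweight. -/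

section Galleries

variable {ι M N : Type*} [AddCommGroup M] [Module ℝ M] [AddCommGroup N] [Module ℝ N]

theorem nonpos_of_mem_faceOf {P : RootPairing ι ℝ M N} {x y : N} (hy : y ∈ faceOf P x) {i : ι}
    {n : ℤ} (hx : P.root' i x + n ≤ 0) : P.root' i y + n ≤ 0 := by
  have h := hy (P.reflectionPerm i i) (-n) (by
    simp only [posHalf, mem_ofPred_eq, root'_reflectionPerm_self]
    push_cast
    linarith)
  simp only [posHalf, mem_ofPred_eq, root'_reflectionPerm_self] at h
  push_cast at h
  linarith

/-- Translation by a point with integral root values permutes the affine roots. Concatenation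
displaces by such points, which need not be translations in the affine Weyl group. -/
theorem faceOf_add (P : RootPairing ι ℝ M N) {c : N} (hc : ∀ i, ∃ m : ℤ, P.root' i c = m) (x : N) :
    faceOf P (x + c) = (fun y => y + c) '' faceOf P x := by
  choose m hm using hc
  ext y
  refine ⟨fun hy => ⟨y - c, fun i n h => ?_, sub_add_cancel y c⟩, ?_⟩
  · have := hy i (n - m i) (by
      simp only [posHalf, mem_ofPred_eq, map_add, hm] at h ⊢
      push_cast
      linarith)
    simp only [posHalf, mem_ofPred_eq, map_sub, hm] at this ⊢
    push_cast at this
    linarith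
  · rintro ⟨y, hy, rfl⟩ i n h
    have := hy i (n + m i) (by
      simp only [posHalf, mem_ofPred_eq, map_add, hm] at h ⊢
      push_cast
      linarith)
    simp only [posHalf, mem_ofPred_eq, map_add, hm] at this ⊢
    push_cast at this
    linarith

variable {P : RootPairing ι ℝ M N} [P.IsRootSystem] (b : P.Base)

theorem eq_smul_fundamentalCoweight (j : b.support) {y : N}
    (h : ∀ k : b.support, k ≠ j → P.root' k y = 0) :
    y = P.root' j y • fundamentalCoweight b j := by
  classical
  rw [← sub_eq_zero]
  have h1 : P.toLinearMap.flip.toPerfPair (y - P.root' j y • fundamentalCoweight b j) = 0 := by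
    refine b.toWeightBasis.ext fun k => ?_
    have h2 : P.root' k (y - P.root' j y • fundamentalCoweight b j) = 0 := by
      rw [map_sub, map_smul, root'_fundamentalCoweight]
      by_cases hk : k = j
      · simp [hk]
      · simp [hk, h k hk]
    simpa using h2
  exact (LinearEquiv.map_eq_zero_iff _).1 h1

theorem exists_int_root'_fundamentalCoweight [Finite ι] [P.IsCrystallographic] (j : b.support)
    (i : ι) : ∃ m : ℤ, P.root' i (fundamentalCoweight b j) = m := by
  classical
  induction i using b.induction_add with
  | h₀ i ih =>
    obtain ⟨m, hm⟩ := ih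
    exact ⟨-m, by rw [root'_reflectionPerm_self, hm]; simp⟩
  | h₁ i hi =>
    refine ⟨if (⟨i, hi⟩ : b.support) = j then 1 else 0, ?_⟩
    rw [root'_fundamentalCoweight b j ⟨i, hi⟩]
    split_ifs <;> simp
  | h₂ i k l h ih hk =>
    obtain ⟨m, hm⟩ := ih
    refine ⟨m + if (⟨k, hk⟩ : b.support) = j then 1 else 0, ?_⟩
    have h1 : P.root' l (fundamentalCoweight b j) =
        P.root' i (fundamentalCoweight b j) + P.root' k (fundamentalCoweight b j) := by
      simp [RootPairing.root', h]
    rw [h1, hm, root'_fundamentalCoweight b j ⟨k, hk⟩]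
    split_ifs <;> simp

/-- The line through `ω_j` is the intersection of the linear walls of the other simple roots, and a
face stays in every wall through the point defining it. -/
theorem mem_faceOf_smul_fundamentalCoweight {j : b.support} {s : ℝ} {y : N}
    (hy : y ∈ faceOf P (s • fundamentalCoweight b j)) :
    y = P.root' j y • fundamentalCoweight b j := by
  classical
  refine eq_smul_fundamentalCoweight b j fun k hk => ?_
  have := eq_zero_of_mem_faceOf hy (i := (k : ι)) (n := 0)
    (by rw [map_smul, root'_fundamentalCoweight]; simp [hk])
  simpa using this

omit [P.IsRootSystem] in
theorem exists_root'_pos_of_mem_breakpoints {w : N} {t : ℝ} (ht : t ∈ breakpoints P w) :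
    ∃ (i : ι) (n : ℤ), 0 < P.root' i w ∧ t * P.root' i w + n = 0 := by
  obtain ⟨-, i, n, h1, h2⟩ := ht
  have h2' : t * P.root' i w + n = 0 := by simpa [wall] using h2
  rcases lt_or_gt_of_ne h1 with h | h
  · refine ⟨P.reflectionPerm i i, -n, by rw [root'_reflectionPerm_self]; linarith, ?_⟩
    rw [root'_reflectionPerm_self]
    push_cast
    linarith
  · exact ⟨i, n, h, h2'⟩

theorem isVertex_smul_fundamentalCoweight {j : b.support} {t : ℝ}
    (ht : t ∈ breakpoints P (fundamentalCoweight b j)) :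
    IsVertex P (t • fundamentalCoweight b j) := by
  refine ⟨t • fundamentalCoweight b j, Subset.antisymm
    (singleton_subset_iff.2 (mem_faceOf_self P _)) fun y hy => ?_⟩
  obtain ⟨i, n, h1, h2⟩ := exists_root'_pos_of_mem_breakpoints ht
  have hy' := mem_faceOf_smul_fundamentalCoweight b hy
  have h3 := eq_zero_of_mem_faceOf hy (i := i) (n := n) (by rwa [map_smul, smul_eq_mul])
  rw [hy', map_smul, smul_eq_mul] at h3
  have h4 : P.root' j y = t := mul_right_cancel₀ h1.ne' (by linarith)
  rw [mem_singleton_iff, hy', h4]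

theorem mem_segment_smul_iff {w y : N} {s t : ℝ} (hst : s ≤ t) :
    y ∈ segment ℝ (s • w) (t • w) ↔ ∃ u ∈ Icc s t, u • w = y := by
  have := image_segment ℝ (LinearMap.toSpanSingleton ℝ N w).toAffineMap s t
  rw [segment_eq_Icc hst] at this
  simp only [LinearMap.coe_toAffineMap, LinearMap.toSpanSingleton_apply] at this
  rw [← this]
  rfl

/-- Without breakpoints in between, no affine root changes sign inside the segment. Conversely the
face lies on the line, where the walls met at `s` and `t` bound it. -/
theorem segment_eq_faceOf {j : b.support} {s t : ℝ}
    (hs : s ∈ breakpoints P (fundamentalCoweight b j))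
    (ht : t ∈ breakpoints P (fundamentalCoweight b j)) (hst : s < t)
    (hno : ∀ u ∈ breakpoints P (fundamentalCoweight b j), s < u → ¬ u < t) :
    segment ℝ (s • fundamentalCoweight b j) (t • fundamentalCoweight b j) =
      faceOf P (((s + t) / 2) • fundamentalCoweight b j) := by
  set w := fundamentalCoweight b j
  ext y
  rw [mem_segment_smul_iff hst.le]
  constructor
  · rintro ⟨u, ⟨hsu, hut⟩, rfl⟩ i n h
    simp only [posHalf, mem_ofPred_eq, map_smul, smul_eq_mul] at h ⊢
    by_contra! hlt
    have hbreak (v : ℝ) (hsv : s < v) (hvt : v < t) (hr : P.root' i w ≠ 0)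
        (hv : v * P.root' i w + n = 0) : False :=
      hno v ⟨⟨hs.1.1.trans hsv.le, hvt.le.trans ht.1.2⟩, i, n, hr, by simpa [wall] using hv⟩ hsv hvt
    have hr : P.root' i w ≠ 0 := fun h0 => by rw [h0] at h hlt; linarith
    have hv : -(n : ℝ) / P.root' i w * P.root' i w + n = 0 := by
      rw [div_mul_cancel₀ _ hr]; ring
    rcases lt_or_gt_of_ne hr with h0 | h0
    · refine hbreak (-(n : ℝ) / P.root' i w) ?_ ?_ hr hv
      · rw [lt_div_iff_of_neg h0]; nlinarith
      · refine lt_of_lt_of_le ?_ hut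
        rw [div_lt_iff_of_neg h0]; linarith
    · refine hbreak (-(n : ℝ) / P.root' i w) ?_ ?_ hr hv
      · refine lt_of_le_of_lt hsu ?_
        rw [lt_div_iff₀ h0]; linarith
      · rw [div_lt_iff₀ h0]; nlinarith
  · intro hy
    have hy' := mem_faceOf_smul_fundamentalCoweight b hy
    refine ⟨P.root' j y, ⟨?_, ?_⟩, hy'.symm⟩
    · obtain ⟨i, n, h1, h2⟩ := exists_root'_pos_of_mem_breakpoints hs
      have h3 := hy i n (by
        simp only [posHalf, mem_ofPred_eq, map_smul, smul_eq_mul]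
        nlinarith)
      rw [hy'] at h3
      simp only [posHalf, mem_ofPred_eq, map_smul, smul_eq_mul] at h3
      by_contra! hlt
      nlinarith
    · obtain ⟨i, n, h1, h2⟩ := exists_root'_pos_of_mem_breakpoints ht
      have h3 := nonpos_of_mem_faceOf hy (i := i) (n := n) (by
        simp only [map_smul, smul_eq_mul]
        nlinarith)
      rw [hy'] at h3
      simp only [map_smul, smul_eq_mul] at h3
      by_contra! hlt
      nlinarith

/-- `E` is a segment starting in `v` with direction `d`. -/
def IsSegmentInDirection (d v : N) (E : Set N) : Prop :=
  ∃ c > 0, E = (fun t : ℝ => v + t • d) '' Icc 0 c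

/-- `E` is an edge with vertex `v` in the direction of the fundamental coweight `ω_j`. -/
structure IsCoweightEdge (j : b.support) (v : N) (E : Set N) : Prop where
  isVertex : IsVertex P v
  isFace : IsFace P E
  direction : IsSegmentInDirection (fundamentalCoweight b j) v E

theorem IsCoweightEdge.add {b : P.Base} {j : b.support} {v : N} {E : Set N}
    (h : IsCoweightEdge b j v E) {c : N} (hc : ∀ i, ∃ m : ℤ, P.root' i c = m) :
    IsCoweightEdge b j (v + c) ((fun x => x + c) '' E) := by
  obtain ⟨⟨x, hx⟩, ⟨y, hy⟩, t, ht, hE⟩ := h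
  refine ⟨⟨x + c, ?_⟩, ⟨y + c, ?_⟩, t, ht, ?_⟩
  · rw [faceOf_add P hc, ← hx, image_singleton]
  · rw [faceOf_add P hc, ← hy]
  · rw [hE, image_image]
    refine image_congr fun s _ => ?_
    abel

theorem isCoweightEdge_segment {j : b.support} {s t : ℝ}
    (hs : s ∈ breakpoints P (fundamentalCoweight b j))
    (ht : t ∈ breakpoints P (fundamentalCoweight b j)) (hst : s < t)
    (hno : ∀ u ∈ breakpoints P (fundamentalCoweight b j), s < u → ¬ u < t) :
    IsCoweightEdge b j (s • fundamentalCoweight b j)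
      (segment ℝ (s • fundamentalCoweight b j) (t • fundamentalCoweight b j)) := by
  refine ⟨isVertex_smul_fundamentalCoweight b hs, ⟨_, segment_eq_faceOf b hs ht hst hno⟩,
    t - s, sub_pos.2 hst, ?_⟩
  ext y
  rw [mem_segment_smul_iff hst.le]
  constructor
  · rintro ⟨u, ⟨h1, h2⟩, rfl⟩
    exact ⟨u - s, ⟨by linarith, by linarith⟩, by module⟩
  · rintro ⟨u, ⟨h1, h2⟩, rfl⟩
    exact ⟨s + u, ⟨by linarith, by linarith⟩, by module⟩

theorem zero_mem_breakpoints (j : b.support) :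
    (0 : ℝ) ∈ breakpoints P (fundamentalCoweight b j) := by
  classical
  exact ⟨⟨le_rfl, zero_le_one⟩, j, 0, by rw [root'_fundamentalCoweight]; simp, by simp [wall]⟩

theorem one_mem_breakpoints (j : b.support) :
    (1 : ℝ) ∈ breakpoints P (fundamentalCoweight b j) := by
  classical
  refine ⟨⟨zero_le_one, le_rfl⟩, j, -1, by rw [root'_fundamentalCoweight]; simp, ?_⟩
  simp only [wall, mem_ofPred_eq, one_smul]
  rw [root'_fundamentalCoweight]
  simp

variable [Finite ι]

theorem fundamentalGallery_spec (j : b.support) :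
    (fundamentalGallery b j).vertex 0 = 0 ∧
    (fundamentalGallery b j).vertex (fundamentalGallery b j).length = fundamentalCoweight b j ∧
    ∀ i < (fundamentalGallery b j).length, IsCoweightEdge b j
      ((fundamentalGallery b j).vertex i) ((fundamentalGallery b j).edge i) := by
  set ts : List ℝ := (finite_breakpoints P (fundamentalCoweight b j)).toFinset.sort (· ≤ ·)
    with hts
  have hmem (t : ℝ) : t ∈ ts ↔ t ∈ breakpoints P (fundamentalCoweight b j) := by
    rw [hts, Finset.mem_sort, Set.Finite.mem_toFinset]
  have hsort : ts.Pairwise (· < ·) := (Finset.sortedLT_sort _).pairwise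
  rw [List.pairwise_iff_getElem] at hsort
  have hlen : 0 < ts.length := List.length_pos_of_mem ((hmem 0).2 (zero_mem_breakpoints b j))
  have hle {k l : ℕ} (hk : k < ts.length) (hl : l < ts.length) (h : k ≤ l) : ts[k] ≤ ts[l] := by
    rcases h.eq_or_lt with rfl | h
    · exact le_rfl
    · exact (hsort k l hk hl h).le
  have hbr {k : ℕ} (hk : k < ts.length) : ts[k] ∈ breakpoints P (fundamentalCoweight b j) :=
    (hmem _).1 (List.getElem_mem hk)
  refine ⟨?_, ?_, fun i hi => ?_⟩
  · change ts.getD 0 0 • fundamentalCoweight b j = 0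
    rw [List.getD_eq_getElem _ _ hlen]
    obtain ⟨k, hk, h0⟩ := List.getElem_of_mem ((hmem 0).2 (zero_mem_breakpoints b j))
    have h1 := hle hlen hk (Nat.zero_le k)
    rw [h0] at h1
    rw [le_antisymm h1 (hbr hlen).1.1, zero_smul]
  · change ts.getD (ts.length - 1) 0 • fundamentalCoweight b j = _
    have hlast : ts.length - 1 < ts.length := by omega
    rw [List.getD_eq_getElem _ _ hlast]
    obtain ⟨k, hk, h0⟩ := List.getElem_of_mem ((hmem 1).2 (one_mem_breakpoints b j))
    have h1 := hle hk hlast (by omega)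
    rw [h0] at h1
    rw [le_antisymm (hbr hlast).1.2 h1, one_smul]
  · change i < ts.length - 1 at hi
    change IsCoweightEdge b j (ts.getD i 0 • fundamentalCoweight b j)
      (segment ℝ (ts.getD i 0 • fundamentalCoweight b j)
        (ts.getD (i + 1) 0 • fundamentalCoweight b j))
    have h1 : i < ts.length := by omega
    have h2 : i + 1 < ts.length := by omega
    rw [List.getD_eq_getElem _ _ h1, List.getD_eq_getElem _ _ h2]
    refine isCoweightEdge_segment b (hbr h1) (hbr h2) (hsort i (i + 1) h1 h2 (by omega))
      fun u hu hu1 hu2 => ?_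
    obtain ⟨k, hk, rfl⟩ := List.getElem_of_mem ((hmem u).2 hu)
    have hik : i < k := by
      by_contra! h
      exact (hle hk h1 h).not_gt hu1
    exact (hle h2 hk hik).not_gt hu2

variable [P.IsCrystallographic]

/-- `K` records the node of each edge, and sortedness of `l` makes it monotone. Integrality at the
end point is carried along so that the next displacement preserves faces; `k₀` only supplies a value
for the empty gallery. -/
theorem foldl_concat_spec {n : ℕ} (e : Fin n → b.support) (k₀ : Fin n) (l : List (Fin n))
    (hl : l.Pairwise (· ≤ ·)) :
    let G := (l.map fun k => fundamentalGallery b (e k)).foldl Gallery.concat (Gallery.point 0)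
    (∀ i, ∃ m : ℤ, P.root' i (G.vertex G.length) = m) ∧
      ∃ K : ℕ → Fin n, (∀ i < G.length, K i ∈ l ∧
        IsCoweightEdge b (e (K i)) (G.vertex i) (G.edge i)) ∧
        ∀ i, i + 1 < G.length → K i ≤ K (i + 1) := by
  induction l using List.reverseRecOn with
  | nil =>
    exact ⟨fun i => ⟨0, by simp [Gallery.point]⟩, fun _ => k₀, fun i hi =>
      absurd hi (Nat.not_lt_zero i), fun _ _ => le_rfl⟩
  | append_singleton l k ih =>
    rw [List.pairwise_append] at hl
    obtain ⟨hint, K, hK, hmono⟩ := ih hl.1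
    simp only [List.map_append, List.map_cons, List.map_nil, List.foldl_append, List.foldl_cons,
      List.foldl_nil]
    generalize (l.map fun k => fundamentalGallery b (e k)).foldl Gallery.concat
      (Gallery.point 0) = G at *
    obtain ⟨h0, h1, hedge⟩ := fundamentalGallery_spec b (e k)
    set G' := fundamentalGallery b (e k)
    have hvert (m : ℕ) : (G.concat G').vertex (G.length + m) =
        G'.vertex m + G.vertex G.length := by
      rcases Nat.eq_zero_or_pos m with rfl | hm
      · simp [Gallery.concat, h0]
      · simp [Gallery.concat, h0, hm.ne']
    have hedge' (m : ℕ) : (G.concat G').edge (G.length + m) =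
        (fun x => x + G.vertex G.length) '' G'.edge m := by
      simp [Gallery.concat, h0]
    have hlen : (G.concat G').length = G.length + G'.length := rfl
    refine ⟨fun i => ?_, fun i => if i < G.length then K i else k, fun i hi => ?_, fun i hi => ?_⟩
    · rw [hlen, hvert, h1, map_add]
      obtain ⟨m, hm⟩ := hint i
      obtain ⟨m', hm'⟩ := exists_int_root'_fundamentalCoweight b (e k) i
      exact ⟨m' + m, by rw [hm, hm']; simp⟩
    · beta_reduce
      by_cases hiG : i < G.length
      · rw [if_pos hiG]
        refine ⟨List.mem_append_left _ (hK i hiG).1, ?_⟩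
        simpa [Gallery.concat, hiG, hiG.le] using (hK i hiG).2
      · obtain ⟨m, rfl⟩ := Nat.exists_eq_add_of_le (not_lt.1 hiG)
        rw [if_neg hiG, hvert, hedge']
        exact ⟨by simp, (hedge m (by omega)).add hint⟩
    · beta_reduce
      by_cases hiG : i + 1 < G.length
      · rw [if_pos hiG, if_pos (by omega)]
        exact hmono i hiG
      · rw [if_neg hiG]
        split_ifs with h
        · exact hl.2.2 _ (hK i h).1 k (by simp)
        · exact le_rfl

theorem dominantGallery_spec {n : ℕ} (e : Fin n ≃ b.support) (a : Fin n → ℕ) (k₀ : Fin n) :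
    ∃ K : ℕ → Fin n, (∀ i < (dominantGallery b e a).length, a (K i) ≠ 0 ∧
      IsCoweightEdge b (e (K i)) ((dominantGallery b e a).vertex i)
        ((dominantGallery b e a).edge i)) ∧
      ∀ i, i + 1 < (dominantGallery b e a).length → K i ≤ K (i + 1) := by
  have hl : ((List.finRange n).flatMap fun i => List.replicate (a i) i).Pairwise (· ≤ ·) := by
    rw [List.pairwise_flatMap]
    refine ⟨fun i _ => by simp [List.pairwise_replicate], ?_⟩
    refine (List.pairwise_lt_finRange n).imp fun {i j} hij x hx y hy => ?_
    rw [List.eq_of_mem_replicate hx, List.eq_of_mem_replicate hy]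
    exact hij.le
  obtain ⟨-, K, hK, hmono⟩ := foldl_concat_spec b e k₀ _ hl
  have heq : (((List.finRange n).flatMap fun i => List.replicate (a i) i).map
      fun k => fundamentalGallery b (e k)).foldl Gallery.concat (Gallery.point 0) =
      dominantGallery b e a := by
    simp only [dominantGallery, List.map_flatMap, List.map_replicate]
  rw [heq] at hK hmono
  refine ⟨K, fun i hi => ⟨fun h0 => ?_, (hK i hi).2⟩, hmono⟩
  obtain ⟨k, -, hk⟩ := List.mem_flatMap.1 (hK i hi).1
  have := List.mem_replicate.1 hk
  rw [this.2] at h0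
  exact this.1 h0

end Galleries

/-! ### From local foldings to a defining chain. -/

section DefiningChains

variable {ι M N : Type*} [Finite ι] [AddCommGroup M] [Module ℝ M] [AddCommGroup N] [Module ℝ N]
  {P : RootPairing ι ℝ M N} [P.IsRootSystem]

/-! ### Directions of edges -/

theorem IsSegmentInDirection.left_mem {d v : N} {E : Set N} (h : IsSegmentInDirection d v E) :
    v ∈ E := by
  obtain ⟨c, hc, rfl⟩ := h
  exact ⟨0, ⟨le_rfl, hc.le⟩, by simp⟩

theorem fundamentalCoweight_mem_dominantChamber [P.IsCrystallographic] (b : P.Base)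
    (j : b.support) : fundamentalCoweight b j ∈ dominantChamber b := by
  classical
  intro i hi
  refine hi.induction_on_add (p := fun i => 0 ≤ P.root' i (fundamentalCoweight b j))
    (fun i hi => ?_) fun i k l h hi hk => ?_
  · rw [root'_fundamentalCoweight b j ⟨i, hi⟩]
    split_ifs <;> simp
  · have h1 : P.root' l (fundamentalCoweight b j) =
        P.root' i (fundamentalCoweight b j) + P.root' k (fundamentalCoweight b j) := by
      simp [RootPairing.root', h]
    rw [h1, root'_fundamentalCoweight b j ⟨k, hk⟩]
    split_ifs <;> linarith

variable [P.IsCrystallographic] [P.IsReduced] {b : P.Base}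

/-- An edge having the type of an edge in the direction of `ω_j` has as direction a Weyl group
conjugate of `ω_j`. -/
theorem exists_isSegmentInDirection_of_faceType_eq {j : b.support} {v v' : N} {E E' : Set N}
    (h' : IsCoweightEdge b j v' E') (hv : IsVertex P v) (hE : IsFace P E) (hvE : v ∈ E)
    (hEE' : faceType b E = faceType b E') (hvv' : faceType b {v} = faceType b {v'}) :
    ∃ w : weylGroup P,
      IsSegmentInDirection ((w : N ≃ₗ[ℝ] N) (fundamentalCoweight b j)) v E := by
  have hv'E' := h'.direction.left_mem
  obtain ⟨hvert, ⟨y, rfl⟩, c, hc, hEeq⟩ := h'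
  obtain ⟨x, rfl⟩ := hE
  obtain ⟨g, hg, hgE, rfl⟩ :=
    exists_image_eq_of_faceType_eq hv hvert hvE hv'E' hEE' hvv'
  obtain ⟨w, q, -, hwq⟩ := exists_weylGroup_add P hg
  refine ⟨w, c, hc, ?_⟩
  rw [← hgE, hEeq, image_image]
  refine image_congr fun t _ => ?_
  rw [hwq, hwq, map_add, map_smul]
  abel

omit [P.IsRootSystem] [P.IsCrystallographic] [P.IsReduced] [Finite ι] in
theorem mem_chamber_of_subset_sector {C : Set N} (hC : IsChamber P C) {d v : N} {E : Set N}
    (hE : IsSegmentInDirection d v E) (h : E ⊆ sector v C) : d ∈ C := by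
  obtain ⟨x, -, rfl⟩ := hC
  obtain ⟨c, hc, rfl⟩ := hE
  obtain ⟨z, hz, hzd⟩ := h ⟨c, ⟨hc.le, le_rfl⟩, rfl⟩
  rw [add_left_cancel hzd] at hz
  intro i hi
  have := hz i hi
  rw [map_smul, smul_eq_mul] at this
  exact nonneg_of_mul_nonneg_right this hc

omit [P.IsReduced] in
variable (b) in
theorem exists_mapsTo_dominantChamber {C : Set N} (hC : IsChamber P C) :
    ∃ w : weylGroup P, ∀ y ∈ C, (w : N ≃ₗ[ℝ] N) y ∈ dominantChamber b := by
  obtain ⟨x, hx, rfl⟩ := hC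
  obtain ⟨w, hw⟩ := exists_apply_mem_dominantChamber b x
  refine ⟨w, fun y hy i hi => ?_⟩
  obtain ⟨k, hk, -⟩ := exists_root'_apply_weylGroup P w i
  have h := hw i hi
  rw [hk] at h ⊢
  exact hy k (lt_of_le_of_ne h (hx k).symm)

omit [P.IsRootSystem] [P.IsCrystallographic] [P.IsReduced] [Finite ι] in
theorem IsSegmentInDirection.affineReflection {d v : N} {E : Set N}
    (h : IsSegmentInDirection d v E) {i : ι} {n : ℤ} (hv : v ∈ wall P i n) :
    IsSegmentInDirection (P.coreflection i d) v (affineReflection P i n '' E) := by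
  obtain ⟨c, hc, rfl⟩ := h
  refine ⟨c, hc, ?_⟩
  rw [image_image]
  refine image_congr fun t _ => ?_
  have hv' : P.root' i v + n = 0 := hv
  have h1 : P.root' i (v + t • d) + n = t * P.root' i d := by
    rw [map_add, map_smul, smul_eq_mul]
    linarith
  rw [affineReflection_apply, h1, P.coreflection_apply]
  module

omit [P.IsReduced] in
/-- The reflection of a positive folding is the reflection in a positive root that is positive on
the new direction. -/
theorem exists_isPos_of_separates {d v : N} {F : Set N} (hF : IsFace P F)
    (hd : IsSegmentInDirection d v F) {i : ι} {n : ℤ} (hv : v ∈ wall P i n) {Ω : Set N}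
    (h : Separates P i n (Ω ∪ sector v (antidominantChamber b)) F) :
    ∃ k, b.IsPos k ∧ weylReflection P k = weylReflection P i ∧ 0 < P.root' k d := by
  obtain ⟨p, hp⟩ := exists_isAlcoveInterior b
  have hv' : P.root' i v + n = 0 := hv
  -- Separation is tested at two points: `v - p` in the antidominant sector gives the sign of the
  -- root at `p`, and `x` in the open face gives its sign on `d`.
  have hmem : v + -p ∈ Ω ∪ sector v (antidominantChamber b) := by
    refine Or.inr ⟨-p, fun k hk => ?_, rfl⟩
    rw [map_neg]
    linarith [(hp k hk).1]
  obtain ⟨c, -, hFc⟩ := hd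
  obtain ⟨x, rfl⟩ := hF
  have hx : x ∈ openFace P (faceOf P x) := rfl
  obtain ⟨t, ⟨ht, -⟩, htx⟩ : x ∈ (fun t : ℝ => v + t • d) '' Icc 0 c := by
    rw [← hFc]
    exact mem_faceOf_self P x
  have hxi : P.root' i x + n = t * P.root' i d := by
    rw [← htx, map_add, map_smul, smul_eq_mul]
    linarith
  rcases h with ⟨h1, h2⟩ | ⟨h1, h2⟩
  · have h3 := h1 hmem
    have h4 := h2 hx
    simp only [negHalf, mem_compl_iff, mem_ofPred_eq, map_add, map_neg, not_le] at h3 h4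
    rw [hxi] at h4
    refine ⟨i, (hp.pos_iff i).1 (lt_of_le_of_ne (by linarith) (hp.ne_zero i).symm), rfl, ?_⟩
    exact pos_of_mul_pos_right h4 ht
  · have h3 := h1 hmem
    have h4 := h2 hx
    simp only [posHalf, mem_compl_iff, mem_ofPred_eq, map_add, map_neg, not_le] at h3 h4
    rw [hxi] at h4
    refine ⟨P.reflectionPerm i i, ?_, Subtype.ext (coreflection_reflectionPerm_self P i), ?_⟩
    · rw [isPos_reflectionPerm_self, ← hp.neg_iff]
      exact lt_of_le_of_ne (by linarith) (hp.ne_zero i)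
    · rw [root'_reflectionPerm_self]
      have := pos_of_mul_pos_right (a := t) (b := -P.root' i d) (by linarith) ht
      exact this

/-- Induction peels off the last folding, with `k` positive on the new direction. If `τ` represents
the previous direction, then `k` is negative on `τ ω_j`; as `ω_j` is dominant, `τ⁻¹ k` is negative,
so `s_k τ` lies below `τ`. Allowing every `σ` lets the starting representative be dictated by the
preceding edge. -/
theorem exists_bruhatLE_of_foldings (j : b.support) {v : N} (s : ℕ) (Fs : ℕ → Set N)
    (hface : ∀ t ≤ s, IsFace P (Fs t)) (hfold : ∀ t < s, IsPositiveFolding b v (Fs t) (Fs (t + 1)))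
    (w : weylGroup P)
    (hw : IsSegmentInDirection ((w : N ≃ₗ[ℝ] N) (fundamentalCoweight b j)) v (Fs s)) :
    ∃ w₀ : weylGroup P,
      IsSegmentInDirection ((w₀ : N ≃ₗ[ℝ] N) (fundamentalCoweight b j)) v (Fs 0) ∧
      ∀ σ : weylGroup P, (σ : N ≃ₗ[ℝ] N) (fundamentalCoweight b j) =
        (w₀ : N ≃ₗ[ℝ] N) (fundamentalCoweight b j) →
        ∃ τ : weylGroup P, (τ : N ≃ₗ[ℝ] N) (fundamentalCoweight b j) =
          (w : N ≃ₗ[ℝ] N) (fundamentalCoweight b j) ∧ BruhatLE b τ σ := by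
  induction s generalizing w with
  | zero => exact ⟨w, hw, fun σ hσ => ⟨σ, hσ, bruhatLE_refl σ⟩⟩
  | succ s ih =>
    obtain ⟨i, n, hv, hF, hsep⟩ := hfold s (Nat.lt_succ_self s)
    obtain ⟨k, hk, hki, hpos⟩ := exists_isPos_of_separates (hface (s + 1) le_rfl) hw hv hsep
    have hFs : Fs s = affineReflection P i n '' Fs (s + 1) := by
      rw [hF, image_image]
      simp [affineReflection_affineReflection]
    obtain ⟨w₀, hw₀, h⟩ := ih (fun t ht => hface t (ht.trans (Nat.le_succ s)))
      (fun t ht => hfold t (ht.trans (Nat.lt_succ_self s))) (weylReflection P i * w) (by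
        rw [hFs]
        exact hw.affineReflection hv)
    refine ⟨w₀, hw₀, fun σ hσ => ?_⟩
    obtain ⟨τ, hτ, hle⟩ := h σ hσ
    rw [← hki] at hτ
    refine ⟨weylReflection P k * τ, ?_, BruhatLE.trans ?_ hle⟩
    · rw [Subgroup.coe_mul, LinearEquiv.mul_apply, hτ, Subgroup.coe_mul, LinearEquiv.mul_apply,
        coe_weylReflection, P.coreflection_same]
    · obtain ⟨p, hp⟩ := exists_isAlcoveInterior b
      refine bruhatLE_reflection_mul hp hk ?_
      obtain ⟨l, hl, -⟩ := exists_root'_apply_weylGroup P τ k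
      have h1 : P.root' l (fundamentalCoweight b j) < 0 := by
        rw [← hl, hτ, Subgroup.coe_mul, LinearEquiv.mul_apply, coe_weylReflection,
          ← root'_reflectionPerm, root'_reflectionPerm_self]
        linarith
      rw [hl, hp.neg_iff]
      exact fun hlpos => (fundamentalCoweight_mem_dominantChamber b j l hlpos).not_gt h1

/-- The directions of a positively folded two-step gallery have representatives in the Weyl group
that are comparable in the Bruhat order. -/
theorem exists_bruhatLE_of_twoStep {j k : b.support} {v₀ v : N} {E F : Set N} {w w' : weylGroup P}
    (hE : IsSegmentInDirection ((w : N ≃ₗ[ℝ] N) (fundamentalCoweight b j)) v₀ E)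
    (hF : IsSegmentInDirection ((w' : N ≃ₗ[ℝ] N) (fundamentalCoweight b k)) v F)
    (h : IsPositivelyFoldedTwoStep b v₀ E v F) :
    ∃ σ τ : weylGroup P,
      (σ : N ≃ₗ[ℝ] N) (fundamentalCoweight b j) = (w : N ≃ₗ[ℝ] N) (fundamentalCoweight b j) ∧
      (τ : N ≃ₗ[ℝ] N) (fundamentalCoweight b k) = (w' : N ≃ₗ[ℝ] N) (fundamentalCoweight b k) ∧
      BruhatLE b τ σ := by
  obtain ⟨s, Fs, hedge, ⟨C, hC, hEC, hFC⟩, rfl, hfold⟩ := h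
  obtain ⟨w₀, hw₀, key⟩ :=
    exists_bruhatLE_of_foldings k s Fs (fun t ht => (hedge t ht).1.1) hfold w' hF
  obtain ⟨u, hu⟩ := exists_mapsTo_dominantChamber b hC
  -- `u⁻¹` carries the dominant chamber onto `C`, so it represents every coweight direction in `C`,
  -- in particular those of both edges of the minimal pair.
  have hinv {j : b.support} {w : weylGroup P}
      (hw : (w : N ≃ₗ[ℝ] N) (fundamentalCoweight b j) ∈ C) :
      ((u⁻¹ : weylGroup P) : N ≃ₗ[ℝ] N) (fundamentalCoweight b j) =
        (w : N ≃ₗ[ℝ] N) (fundamentalCoweight b j) := by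
    have h := (eq_of_mem_dominantChamber (fundamentalCoweight_mem_dominantChamber b j) (hu _ hw)
      (u * w) rfl).1
    conv_lhs => rw [h]
    exact (u : N ≃ₗ[ℝ] N).symm_apply_apply _
  obtain ⟨τ, hτ, hle⟩ := key u⁻¹ (hinv (mem_chamber_of_subset_sector hC hw₀ hFC))
  exact ⟨u⁻¹, τ, hinv (mem_chamber_of_subset_sector hC hE hEC), hτ, hle⟩

/-! ### Splicing chains -/

-- An element is determined by its action on the roots. Finiteness bounds the lengths and so lets
-- the upward pushing stop.
omit [P.IsCrystallographic] [P.IsReduced] in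
variable (P) in
theorem finite_weylGroup : Finite (weylGroup P) := by
  choose f hf _ using exists_root'_apply_weylGroup P
  refine Finite.of_injective f fun w w' h => ?_
  ext x
  rw [← sub_eq_zero]
  refine eq_zero_of_root'_eq_zero P fun i => ?_
  rw [map_sub, hf, hf, h, sub_self]

omit [P.IsReduced] [P.IsCrystallographic] [Finite ι] in
theorem weylProd_apply_fundamentalCoweight {j : b.support} {l : List ι}
    (hl : ∀ i ∈ l, i ∈ b.support ∧ i ≠ j) :
    (weylProd P l : N ≃ₗ[ℝ] N) (fundamentalCoweight b j) = fundamentalCoweight b j := by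
  classical
  induction l with
  | nil => rfl
  | cons i l ih =>
    obtain ⟨hi, hij⟩ := hl i (by simp)
    rw [weylProd_cons, Subgroup.coe_mul, LinearEquiv.mul_apply, ih fun k hk => hl k (by simp [hk]),
      coe_weylReflection, P.coreflection_apply, root'_fundamentalCoweight b j ⟨i, hi⟩,
      if_neg fun h => hij (congrArg Subtype.val h), zero_smul, sub_zero]

omit [P.IsRootSystem] [P.IsCrystallographic] [P.IsReduced] [Finite ι] in
theorem bruhatUp_eq_mul_weylProd (i : ι) (w : weylGroup P) :
    bruhatUp b i w = w * weylProd P [i] ∨ bruhatUp b i w = w * weylProd P [] := by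
  unfold bruhatUp
  split_ifs <;> simp

omit [P.IsRootSystem] [P.IsCrystallographic] [P.IsReduced] [Finite ι] in
theorem bruhatDown_eq_mul_weylProd (i : ι) (w : weylGroup P) :
    bruhatDown b i w = w * weylProd P [i] ∨ bruhatDown b i w = w * weylProd P [] := by
  unfold bruhatDown
  split_ifs <;> simp

/-- A descending chain can be moved within its cosets modulo a parabolic subgroup such that its
last element becomes maximal in its coset. -/
theorem exists_chain_isMax {J : Set ι} (hJ : J ⊆ b.support) (m : ℕ) (τ : ℕ → weylGroup P)
    (hτ : ∀ i < m, BruhatLE b (τ (i + 1)) (τ i)) :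
    ∃ τ' : ℕ → weylGroup P, (∀ i < m, BruhatLE b (τ' (i + 1)) (τ' i)) ∧
      (∀ i, ∃ l : List ι, (∀ k ∈ l, k ∈ J) ∧ τ' i = τ i * weylProd P l) ∧
      ∀ k ∈ J, bruhatUp b k (τ' m) = τ' m := by
  have := finite_weylGroup P
  obtain ⟨B, hB⟩ := (finite_range (weylLength b)).bddAbove
  induction hn : B - weylLength b (τ m) using Nat.strong_induction_on generalizing τ with
  | _ n ih =>
    by_cases hmax : ∀ k ∈ J, bruhatUp b k (τ m) = τ m
    · exact ⟨τ, hτ, fun i => ⟨[], by simp, by simp⟩, hmax⟩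
    push Not at hmax
    obtain ⟨k, hk, hne⟩ := hmax
    have hlt : weylLength b (τ m) < weylLength b (bruhatUp b k (τ m)) := by
      unfold bruhatUp at hne ⊢
      split_ifs with h
      · exact h
      · exact absurd (if_neg h) hne
    have hle : weylLength b (bruhatUp b k (τ m)) ≤ B := hB ⟨_, rfl⟩
    -- The whole chain is pushed at once, which keeps it descending; the last element becomes
    -- strictly longer.
    obtain ⟨τ', h1, h2, h3⟩ := ih _ (by omega) (fun i => bruhatUp b k (τ i))
      (fun i hi => bruhatUp_mono (hτ i hi) (hJ hk)) rfl
    refine ⟨τ', h1, fun i => ?_, h3⟩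
    obtain ⟨l, hl, hl'⟩ := h2 i
    rcases bruhatUp_eq_mul_weylProd (b := b) k (τ i) with h | h
    · exact ⟨[k] ++ l, by simpa using ⟨hk, hl⟩, by rw [hl', h, weylProd_append, mul_assoc]⟩
    · exact ⟨[] ++ l, by simpa using hl, by rw [hl', h, weylProd_append, mul_assoc]⟩

/-- Dual to `exists_chain_isMax`: as long as some `k` in `J` shortens `σ`, `bruhatDown` is applied
to both elements, and the length of `σ` drops. -/
theorem exists_pair_isMin {J : Set ι} (hJ : J ⊆ b.support) (σ τ : weylGroup P)
    (h : BruhatLE b τ σ) :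
    ∃ l l' : List ι, (∀ k ∈ l, k ∈ J) ∧ (∀ k ∈ l', k ∈ J) ∧
      BruhatLE b (τ * weylProd P l') (σ * weylProd P l) ∧
      ∀ k ∈ J, bruhatDown b k (σ * weylProd P l) = σ * weylProd P l := by
  induction hn : weylLength b σ using Nat.strong_induction_on generalizing σ τ with
  | _ n ih =>
    by_cases hmin : ∀ k ∈ J, bruhatDown b k σ = σ
    · exact ⟨[], [], by simp, by simp, by simpa using h, by simpa using hmin⟩
    push Not at hmin
    obtain ⟨k, hk, hne⟩ := hmin
    have hlt : weylLength b (bruhatDown b k σ) < weylLength b σ := by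
      unfold bruhatDown at hne ⊢
      split_ifs with h
      · exact h
      · exact absurd (if_neg h) hne
    obtain ⟨l, l', hl, hl', h1, h2⟩ := ih _ (by omega) _ _ (bruhatDown_mono h (hJ hk)) rfl
    have key (w : weylGroup P) (l : List ι) (hl : ∀ k ∈ l, k ∈ J) :
        ∃ l₁ : List ι, (∀ k ∈ l₁, k ∈ J) ∧
          bruhatDown b k w * weylProd P l = w * weylProd P l₁ := by
      rcases bruhatDown_eq_mul_weylProd (b := b) k w with h | h
      · exact ⟨[k] ++ l, by simpa using ⟨hk, hl⟩, by rw [h, weylProd_append, mul_assoc]⟩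
      · exact ⟨[] ++ l, by simpa using hl, by rw [h, weylProd_append, mul_assoc]⟩
    obtain ⟨l₁, hl₁, h₁⟩ := key σ l hl
    obtain ⟨l₂, hl₂, h₂⟩ := key τ l' hl'
    refine ⟨l₁, l₂, hl₁, hl₂, ?_, ?_⟩
    · rwa [← h₁, ← h₂]
    · rwa [← h₁]

omit [P.IsRootSystem] [P.IsCrystallographic] [P.IsReduced] [Finite ι] in
/-- A product of reflections from two mutually commuting sets can be sorted. -/
theorem exists_weylProd_eq_mul {J J' : Set ι}
    (hcomm : ∀ i ∈ J, ∀ k ∈ J', Commute (weylReflection P i) (weylReflection P k)) (l : List ι)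
    (hl : ∀ i ∈ l, i ∈ J ∨ i ∈ J') :
    ∃ l₁ l₂ : List ι, (∀ i ∈ l₁, i ∈ J) ∧ (∀ i ∈ l₂, i ∈ J') ∧
      weylProd P l = weylProd P l₁ * weylProd P l₂ := by
  induction l with
  | nil => exact ⟨[], [], by simp, by simp, by simp⟩
  | cons i l ih =>
    obtain ⟨l₁, l₂, h1, h2, h3⟩ := ih fun k hk => hl k (by simp [hk])
    rcases hl i (by simp) with hi | hi
    · exact ⟨i :: l₁, l₂, by simpa using ⟨hi, h1⟩, h2, by simp [h3, mul_assoc]⟩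
    · refine ⟨l₁, i :: l₂, h1, by simpa using ⟨hi, h2⟩, ?_⟩
      have hc : Commute (weylProd P l₁) (weylReflection P i) := by
        clear h3
        induction l₁ with
        | nil => simp
        | cons k l₁ ih' =>
          rw [weylProd_cons]
          exact (hcomm k (h1 k (by simp)) i hi).mul_left (ih' fun x hx => h1 x (by simp [hx]))
      rw [weylProd_cons, weylProd_cons, h3, ← mul_assoc, ← mul_assoc, hc.eq]

omit [P.IsRootSystem] [P.IsCrystallographic] [P.IsReduced] [Finite ι] in
theorem weylProd_mul_weylProd_reverse (l : List ι) : weylProd P l * weylProd P l.reverse = 1 := by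
  induction l with
  | nil => simp
  | cons i l ih =>
    rw [List.reverse_cons, weylProd_append, weylProd_cons, weylProd_cons, weylProd_nil, mul_one,
      mul_assoc, ← mul_assoc (weylProd P l), ih, one_mul, weylReflection_mul_self]

omit [P.IsRootSystem] [P.IsCrystallographic] [P.IsReduced] [Finite ι] in
theorem commute_weylReflection_of_not_adj {j k : b.support} (hjk : j ≠ k)
    (h : ¬ (dynkinGraph b).Adj j k) :
    Commute (weylReflection P (j : ι)) (weylReflection P (k : ι)) := by
  rw [dynkinGraph, SimpleGraph.fromRel_adj] at h
  push Not at h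
  obtain ⟨h1, h2⟩ := h hjk
  have := RootPairing.isOrthogonal_comm P.flip (i := (j : ι)) (j := (k : ι)) ⟨h2, h1⟩
  exact Subtype.ext this

/-- Chains for pieces of a gallery can be spliced at an edge whose node separates the preceding
nodes from the following ones. -/
theorem exists_chain {n : ℕ} (e : Fin n ≃ b.support) (a : Fin n → ℕ) (hstar : ConditionStar b e a)
    (K : ℕ → Fin n) (L : ℕ) (ha : ∀ i < L, a (K i) ≠ 0) (hmono : ∀ i, i + 1 < L → K i ≤ K (i + 1))
    (d : ℕ → N)
    (hd : ∀ i < L, ∃ w : weylGroup P, (w : N ≃ₗ[ℝ] N) (fundamentalCoweight b (e (K i))) = d i)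
    (hloc : ∀ i, i + 1 < L → ∃ σ τ : weylGroup P,
      (σ : N ≃ₗ[ℝ] N) (fundamentalCoweight b (e (K i))) = d i ∧
      (τ : N ≃ₗ[ℝ] N) (fundamentalCoweight b (e (K (i + 1)))) = d (i + 1) ∧ BruhatLE b τ σ) :
    ∃ τ : ℕ → weylGroup P,
      (∀ i < L, (τ i : N ≃ₗ[ℝ] N) (fundamentalCoweight b (e (K i))) = d i) ∧
      ∀ i, i + 1 < L → BruhatLE b (τ (i + 1)) (τ i) := by
  classical
  induction L with
  | zero => exact ⟨fun _ => 1, by simp, by simp⟩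
  | succ L ih =>
    rcases Nat.eq_zero_or_pos L with rfl | hL
    · obtain ⟨w, hw⟩ := hd 0 one_pos
      refine ⟨fun _ => w, fun i hi => ?_, fun i hi => by omega⟩
      obtain rfl : i = 0 := by omega
      exact hw
    obtain ⟨m, rfl⟩ : ∃ m, L = m + 1 := ⟨L - 1, by omega⟩
    obtain ⟨τ, hτ, hτle⟩ := ih (fun i hi => ha i (by omega)) (fun i hi => hmono i (by omega))
      (fun i hi => hd i (by omega)) fun i hi => hloc i (by omega)
    obtain ⟨σ, ρ, hσ, hρ, hle⟩ := hloc m (by omega)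
    set k := K m with hk
    have hKle (i : ℕ) (hi : i ≤ m) : K i ≤ k := by
      induction hi using Nat.decreasingInduction with
      | self => exact le_rfl
      | of_succ i hi ih' => exact (hmono i (by omega)).trans ih'
    -- The nodes after and before `k`. The earlier chain is adjusted by the former, the new pair by
    -- the latter, and neither changes the edge directions involved.
    set Jup : Set ι := {i | ∃ j, k < j ∧ (e j : ι) = i} with hJup
    set Jlow : Set ι := {i | ∃ j, j < k ∧ (e j : ι) = i} with hJlow
    have hup : Jup ⊆ b.support := by rintro _ ⟨j, -, rfl⟩; exact (e j).2
    have hlow : Jlow ⊆ b.support := by rintro _ ⟨j, -, rfl⟩; exact (e j).2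
    obtain ⟨τ', hτ'le, hτ', hmax⟩ := exists_chain_isMax hup m τ fun i hi => hτle i (by omega)
    obtain ⟨l, l', hl, hl', hle', hmin⟩ := exists_pair_isMin hlow σ ρ hle
    have hfixup (i : Fin n) (hi : i ≤ k) (l : List ι) (hl : ∀ x ∈ l, x ∈ Jup) :
        (weylProd P l : N ≃ₗ[ℝ] N) (fundamentalCoweight b (e i)) = fundamentalCoweight b (e i) := by
      refine weylProd_apply_fundamentalCoweight fun x hx => ⟨hup (hl x hx), ?_⟩
      obtain ⟨j, hj, rfl⟩ := hl x hx
      intro h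
      rw [e.injective (Subtype.ext h)] at hj
      exact hj.not_ge hi
    have hfixlow (i : Fin n) (hi : k ≤ i) (l : List ι) (hl : ∀ x ∈ l, x ∈ Jlow) :
        (weylProd P l : N ≃ₗ[ℝ] N) (fundamentalCoweight b (e i)) = fundamentalCoweight b (e i) := by
      refine weylProd_apply_fundamentalCoweight fun x hx => ⟨hlow (hl x hx), ?_⟩
      obtain ⟨j, hj, rfl⟩ := hl x hx
      intro h
      rw [e.injective (Subtype.ext h)] at hj
      exact hj.not_ge hi
    have hτ'd (i : ℕ) (hi : i ≤ m) :
        (τ' i : N ≃ₗ[ℝ] N) (fundamentalCoweight b (e (K i))) = d i := by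
      obtain ⟨l, hl, h⟩ := hτ' i
      rw [h, Subgroup.coe_mul, LinearEquiv.mul_apply, hfixup _ (hKle i hi) l hl, hτ i (by omega)]
    set σ' := σ * weylProd P l with hσ'
    have hσ'd : (σ' : N ≃ₗ[ℝ] N) (fundamentalCoweight b (e k)) = d m := by
      rw [hσ', Subgroup.coe_mul, LinearEquiv.mul_apply, hfixlow k le_rfl l hl, hσ]
    have hdom := fundamentalCoweight_mem_dominantChamber b (e k)
    -- Both `τ' m` and `σ'` represent the direction of edge `m`, so they differ by an element of the
    -- stabilizer of `ω_k`, a word in simple reflections other than that of `k`.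
    obtain ⟨-, l₀, hl₀, hprod⟩ := eq_of_mem_dominantChamber hdom hdom ((τ' m)⁻¹ * σ') (by
      rw [Subgroup.coe_mul, LinearEquiv.mul_apply, hσ'd, ← hτ'd m le_rfl]
      exact (τ' m : N ≃ₗ[ℝ] N).symm_apply_apply _)
    -- Here `ConditionStar` enters: as `a k ≠ 0`, nodes before `k` are not joined to nodes after
    -- `k`, so their reflections commute.
    obtain ⟨l₁, l₂, hl₁, hl₂, h12⟩ := exists_weylProd_eq_mul (P := P) (J := Jup) (J' := Jlow) (by
      rintro _ ⟨i, hi, rfl⟩ _ ⟨j, hj, rfl⟩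
      refine (commute_weylReflection_of_not_adj (fun h => ?_)
        (hstar k (ha m (by omega)) j i hj hi)).symm
      exact (hj.trans hi).ne (e.injective h)) l₀ (by
      intro i hi
      obtain ⟨hi, hi0⟩ := hl₀ i hi
      obtain ⟨j, hj⟩ := e.surjective ⟨i, hi⟩
      have hji : (e j : ι) = i := congrArg Subtype.val hj
      rcases lt_trichotomy j k with h | h | h
      · exact Or.inr ⟨j, h, hji⟩
      · rw [← hji, h, root'_fundamentalCoweight, if_pos rfl] at hi0
        exact absurd hi0 one_ne_zero
      · exact Or.inl ⟨j, h, hji⟩)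
    -- `σ' ≤ σ' v⁻¹ = τ' u ≤ τ'`, by minimality modulo `Jlow` and maximality modulo `Jup`.
    have hmid : BruhatLE b σ' (τ' m) := by
      have h1 : BruhatLE b (τ' m * weylProd P l₁) (τ' m) :=
        bruhatLE_of_isMax (fun i hi => hup (hl₁ i hi)) fun i hi => hmax i (hl₁ i hi)
      have h2 : BruhatLE b σ' (σ' * weylProd P l₂.reverse) :=
        bruhatLE_of_isMin (fun i hi => hlow (hl₂ i (List.mem_reverse.1 hi)))
          fun i hi => hmin i (hl₂ i (List.mem_reverse.1 hi))
      have h3 : σ' * weylProd P l₂.reverse = τ' m * weylProd P l₁ := by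
        rw [h12, eq_inv_mul_iff_mul_eq] at hprod
        rw [← hprod, ← mul_assoc, mul_assoc (τ' m * _), weylProd_mul_weylProd_reverse, mul_one]
      rw [h3] at h2
      exact h2.trans h1
    refine ⟨fun i => if i ≤ m then τ' i else ρ * weylProd P l', fun i hi => ?_, fun i hi => ?_⟩
    · beta_reduce
      split_ifs with him
      · exact hτ'd i him
      · obtain rfl : i = m + 1 := by omega
        rw [Subgroup.coe_mul, LinearEquiv.mul_apply, hfixlow _ (hmono m (by omega)) l' hl', hρ]
    · beta_reduce
      rw [if_pos (by omega : i ≤ m)]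
      split_ifs with him
      · exact hτ'le i (by omega)
      · obtain rfl : i = m := by omega
        exact hle'.trans hmid

end DefiningChains

end OneSkeleton

/-! ### The proposition. -/

theorem mainTheorem9 {ι M N : Type*} [Finite ι] [AddCommGroup M] [Module ℝ M]
    [AddCommGroup N] [Module ℝ N] (P : RootPairing ι ℝ M N) [P.IsRootSystem]
    [P.IsCrystallographic] [P.IsReduced] (b : P.Base) {n : ℕ} (e : Fin n ≃ b.support)
    (a : Fin n → ℕ) (hstar : OneSkeleton.ConditionStar b e a) (γ : OneSkeleton.Gallery N)
    (hγ : γ.IsCombinatorial P)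
    (htype : γ.SameType b (OneSkeleton.dominantGallery b e a))
    (hlocal : γ.IsLocallyPositivelyFolded b) :
    γ.IsGloballyPositivelyFolded b := by
  refine ⟨hlocal, ?_⟩
  obtain ⟨hlen, hvtype, hetype⟩ := htype
  rcases Nat.eq_zero_or_pos n with rfl | hn
  · have h0 : γ.length = 0 := hlen
    exact ⟨fun _ => 1, fun i hi => by omega, fun i hi => by omega⟩
  obtain ⟨K, hK, hmono⟩ := OneSkeleton.dominantGallery_spec b e a ⟨0, hn⟩
  rw [← hlen] at hK hmono
  have hdir (i : ℕ) (hi : i < γ.length) : ∃ w : OneSkeleton.weylGroup P,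
      OneSkeleton.IsSegmentInDirection
        ((w : N ≃ₗ[ℝ] N) (OneSkeleton.fundamentalCoweight b (e (K i)))) (γ.vertex i) (γ.edge i) :=
    OneSkeleton.exists_isSegmentInDirection_of_faceType_eq (hK i hi).2 (hγ.isVertex i hi.le)
      (hγ.isEdge i hi).1 (hγ.left_mem i hi) (hetype i hi) (hvtype i hi.le)
  choose! w hw using hdir
  obtain ⟨τ, hτ, hle⟩ := OneSkeleton.exists_chain e a hstar K γ.length (fun i hi => (hK i hi).1)
    hmono (fun i => (w i : N ≃ₗ[ℝ] N) (OneSkeleton.fundamentalCoweight b (e (K i))))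
    (fun i _ => ⟨w i, rfl⟩) fun i hi =>
      OneSkeleton.exists_bruhatLE_of_twoStep (hw i (by omega)) (hw (i + 1) hi) (hlocal i hi)
  refine ⟨τ, fun i hi => ?_, hle⟩
  obtain ⟨c, -, hE⟩ := hw i hi
  rw [hE, ← hτ i hi]
  rintro _ ⟨t, ⟨ht, -⟩, rfl⟩
  refine ⟨_, ⟨t • OneSkeleton.fundamentalCoweight b (e (K i)), fun k hk => ?_, rfl⟩, ?_⟩
  · rw [map_smul, smul_eq_mul]
    exact mul_nonneg ht (OneSkeleton.fundamentalCoweight_mem_dominantChamber b _ k hk)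
  · rw [map_smul]
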